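/- There is a universal constant $C$ such that the following holds. Let $X$ be a set of combinatorial valuations $v:2^{[n]}\to[0,U]$ over $n$ items (values of bundles, with some finite upper bound $U$), and let $\mathcal D$ be a prior (a probability distribution) over $X$. Let $\mathcal M$ be any incentive compatible and individually rational direct mechanism for a single buyer with type in $X$; it assigns to each reported type a lottery over bundles and a nonnegative payment (a measurable function of the type), and we assume that it only ever allocates bundles from a fixed family of $B$ subsets of $[n]$. Then for every $\delta>0$ there is a quantum auction protocol that is (exactly) incentive compatible and individually rational, whose expected revenue under $\mathcal D$ is at least $(1-\delta)$ times the expected revenue of $\mathcal M$, and in which the expected total number of qubits sent is at most $C\log B$, whatever strategy the buyer plays. The constant $C$ does not depend on $n,U,X,\mathcal D,\mathcal M,B,\delta$. Here a quantum auction protocol is an interactive protocol between a seller and a buyer who share no initial entanglement (all qubits start in $|0\rangle$). They take turns, the seller first; in each turn the active party performs a local measurement on the qubits held by that party (including unitary operations) and then either terminates the protocol or sends exactly one qubit to the other party, where all decisions depend on that party's own past measurement outcomes (for the buyer also on his type). At termination, the allocated bundle $S\subseteq[n]$ and the payment $q\in\mathbb R$ are a deterministic function of the seller's measurement outcomes.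 The protocol includes a suggested buyer's strategy for every type $v\in X$, and for every buyer's strategy it terminates with probability one and the payment has finite expectation. It is incentive compatible if for every $v\in X$ the suggested strategy maximizes $\mathbb E[v(S)-q]$ among all buyer's strategies (with any finite number of private qubits), and individually rational if this maximum is nonnegative for every $v\in X$. Its revenue is the expected payment when types are drawn from $\mathcal D$ and the suggested strategies are played. -/

import Mathlib

open MeasureTheory
open scoped ENNReal Kronecker Matrix

/-! ### Valuations and direct mechanisms -/

/-- A combinatorial valuation over `n` items: a value for every bundle. -/
abbrev BundleValuation (n : ℕ) : Type := Finset (Fin n) → ℝ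

/-- A direct mechanism for the type set `X`: a lottery over bundles and a nonnegative (expected)
payment for every reported type. -/
structure Mechanism {n : ℕ} (X : Set (BundleValuation n)) where
  /-- `alloc v S` is the probability that bundle `S` is allocated when `v` is reported. -/
  alloc : X → Finset (Fin n) → ℝ
  /-- The payment charged when `v` is reported. -/
  pay : X → ℝ
  alloc_nonneg : ∀ v S, 0 ≤ alloc v S
  alloc_sum : ∀ v, ∑ S, alloc v S = 1
  pay_nonneg : ∀ v, 0 ≤ pay v

namespace Mechanism

variable {n : ℕ} {X : Set (BundleValuation n)} (M : Mechanism X)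

/-- Expected utility of a buyer of type `v` who reports `w`. -/
def utility (v w : X) : ℝ := ∑ S, M.alloc w S * v.1 S - M.pay w

/-- Incentive compatibility. -/
def IsIC : Prop := ∀ v w : X, M.utility v w ≤ M.utility v v

/-- Individual rationality. -/
def IsIR : Prop := ∀ v : X, 0 ≤ M.utility v v

/-- The mechanism only ever allocates bundles from the family `𝓑`. -/
def AllocatesOnly (𝓑 : Finset (Finset (Fin n))) : Prop := ∀ v, ∀ S ∉ 𝓑, M.alloc v S = 0

/-- Expected revenue under the prior `D`. -/
noncomputable def revenue (D : Measure X) : ℝ := ∫ v, M.pay v ∂D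

end Mechanism

/-! ### Local quantum operations -/

/-- Computational basis labels of a register of `k` qubits. -/
abbrev Reg (k : ℕ) : Type := Fin k → Fin 2

/-- A measurement with finitely many outcomes on a system with basis `ι`, given by operators `A ℓ`
with `∑ ℓ, (A ℓ)ᴴ * A ℓ = 1`. A unitary followed by a measurement is again of this form, and a
unitary alone is the case of a single outcome. -/
structure Measurement (ι : Type) [Fintype ι] [DecidableEq ι] where
  num : ℕ
  op : Fin num → Matrix ι ι ℂ
  complete : ∑ ℓ, (op ℓ)ᴴ * op ℓ = 1

/-- The operator of outcome `ℓ`, extended by `0` to labels that are not outcomes. -/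
def Measurement.kraus {ι : Type} [Fintype ι] [DecidableEq ι] (A : Measurement ι) (ℓ : ℕ) :
    Matrix ι ι ℂ :=
  if h : ℓ < A.num then A.op ⟨ℓ, h⟩ else 0

/-- Basis labels of the whole system: the seller's `a` private qubits, the qubit that travels
between the parties, and the buyer's `b` private qubits. -/
abbrev Sys (a b : ℕ) : Type := Reg a × Fin 2 × Reg b

/-- An operator on the seller's qubits (her private ones and the travelling one, which she holds
on her turns), tensored with the identity on the buyer's private qubits. -/
def onSeller {a : ℕ} (b : ℕ) (A : Matrix (Reg a × Fin 2) (Reg a × Fin 2) ℂ) :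
    Matrix (Sys a b) (Sys a b) ℂ :=
  (A ⊗ₖ (1 : Matrix (Reg b) (Reg b) ℂ)).submatrix
    (Equiv.prodAssoc (Reg a) (Fin 2) (Reg b)).symm (Equiv.prodAssoc (Reg a) (Fin 2) (Reg b)).symm

/-- An operator on the buyer's qubits (the travelling one, which he holds on his turns, and his
private ones), tensored with the identity on the seller's private qubits. -/
def onBuyer (a : ℕ) {b : ℕ} (A : Matrix (Fin 2 × Reg b) (Fin 2 × Reg b) ℂ) :
    Matrix (Sys a b) (Sys a b) ℂ :=
  (1 : Matrix (Reg a) (Reg a) ℂ) ⊗ₖ A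

/-- The effect of a measurement operator on a state that is not normalized: the trace of the
result is the joint probability of everything observed so far. -/
def applyOp {ι : Type} [Fintype ι] (A ρ : Matrix ι ι ℂ) : Matrix ι ι ℂ := A * ρ * Aᴴ

/-- The initial state: every qubit is `|0⟩`. -/
def initialState (a b : ℕ) : Matrix (Sys a b) (Sys a b) ℂ := Matrix.single 0 0 1

/-! ### Strategies

The parties alternate, the seller first. On her or his turn the active party measures the qubits
that she or he holds and then either terminates the protocol or sends exactly one qubit, the
travelling one, to the other party. The local history of a party is the list of that party's own
measurement outcomes, most recent first; its length determines the numbers of qubits that the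
party has sent and received. -/

/-- The seller's side of the protocol: the number of her private qubits, her measurement, her
decision to terminate, and the allocation and payment as functions of her local history.
The allocation and payment also apply when it is the buyer who terminates. -/
structure SellerStrategy (n : ℕ) where
  mem : ℕ
  meas : List ℕ → Measurement (Reg mem × Fin 2)
  halt : List ℕ → Bool
  alloc : List ℕ → Finset (Fin n)
  pay : List ℕ → ℝ

/-- A strategy of the buyer: an arbitrary finite number of private qubits, and a measurement and
a decision to terminate as functions of his local history. -/
structure BuyerStrategy where
  mem : ℕ
  meas : List ℕ → Measurement (Fin 2 × Reg mem)
  quit : List ℕ → Bool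

section Run

variable {n : ℕ} (σ : SellerStrategy n) (s : BuyerStrategy)

/-- The unnormalized state after the seller, holding local history `h`, observes outcome `x`. -/
def sellerStep (h : List ℕ) (x : ℕ) (ρ : Matrix (Sys σ.mem s.mem) (Sys σ.mem s.mem) ℂ) :
    Matrix (Sys σ.mem s.mem) (Sys σ.mem s.mem) ℂ :=
  applyOp (onSeller s.mem ((σ.meas h).kraus x)) ρ

/-- The unnormalized state after the buyer, holding local history `h`, observes outcome `y`. -/
def buyerStep (h : List ℕ) (y : ℕ) (ρ : Matrix (Sys σ.mem s.mem) (Sys σ.mem s.mem) ℂ) :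
    Matrix (Sys σ.mem s.mem) (Sys σ.mem s.mem) ℂ :=
  applyOp (onBuyer σ.mem ((s.meas h).kraus y)) ρ

/-- The unnormalized state at the start of a turn of the seller, after rounds with outcomes `h`
(pairs of a seller's and a buyer's outcome, most recent first) in none of which the protocol
was terminated. -/
def stateAfter : List (ℕ × ℕ) → Matrix (Sys σ.mem s.mem) (Sys σ.mem s.mem) ℂ
  | [] => initialState σ.mem s.mem
  | (x, y) :: h =>
    if σ.halt (x :: h.map Prod.fst) || s.quit (y :: h.map Prod.snd) then 0
    else buyerStep σ s (h.map Prod.snd) y (sellerStep σ s (h.map Prod.fst) x (stateAfter h))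

/-- The ways in which a run can end: `(h, x, none)` when after complete rounds `h` the seller
observes `x` and terminates, `(h, x, some y)` when after complete rounds `h` the seller observes
`x` and sends a qubit, and the buyer observes `y` and terminates. -/
abbrev Ending : Type := List (ℕ × ℕ) × ℕ × Option ℕ

/-- The seller's local history at the time of termination. -/
def Ending.sellerHistory (e : Ending) : List ℕ := e.2.1 :: e.1.map Prod.fst

/-- The total number of qubits sent, by both parties. -/
def Ending.qubits : Ending → ℕ
  | (h, _, none) => 2 * h.length
  | (h, _, some _) => 2 * h.length + 1

/-- The probability that the run ends in the given way. -/
def endProb : Ending → ℝ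
  | (h, x, none) =>
    if σ.halt (x :: h.map Prod.fst) then
      (sellerStep σ s (h.map Prod.fst) x (stateAfter σ s h)).trace.re
    else 0
  | (h, x, some y) =>
    if !σ.halt (x :: h.map Prod.fst) && s.quit (y :: h.map Prod.snd) then
      (buyerStep σ s (h.map Prod.snd) y
        (sellerStep σ s (h.map Prod.fst) x (stateAfter σ s h))).trace.re
    else 0

/-- Expected payment. -/
noncomputable def expectedPayment : ℝ := ∑' e, endProb σ s e * σ.pay e.sellerHistory

/-- Expected utility of a buyer whose true type is `v` and who plays `s`. -/
noncomputable def expectedUtility (v : BundleValuation n) : ℝ :=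
  ∑' e, endProb σ s e * (v (σ.alloc e.sellerHistory) - σ.pay e.sellerHistory)

/-- Expected number of qubits sent, an extended nonnegative real. -/
noncomputable def expectedQubits : ℝ≥0∞ :=
  ∑' e : Ending, ENNReal.ofReal (endProb σ s e) * (e.qubits : ℝ≥0∞)

end Run

/-! ### Quantum auction protocols -/

/-- A single-buyer quantum auction protocol for the type set `X`: the seller's side and a
suggested strategy of the buyer for every type. -/
structure QuantumAuctionProtocol {n : ℕ} (X : Set (BundleValuation n)) where
  seller : SellerStrategy n
  suggested : X → BuyerStrategy

namespace QuantumAuctionProtocol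

variable {n : ℕ} {X : Set (BundleValuation n)} (P : QuantumAuctionProtocol X)

/-- Whatever strategy the buyer plays, the protocol terminates with probability one and the
payment has finite expectation, so that all expectations below are meaningful. -/
def IsProper : Prop :=
  ∀ s : BuyerStrategy, HasSum (endProb P.seller s) 1 ∧
    Summable fun e : Ending => endProb P.seller s e * P.seller.pay e.sellerHistory

/-- Incentive compatibility: no buyer's strategy whatsoever beats the suggested one. -/
def IsIC : Prop :=
  ∀ (v : X) (s : BuyerStrategy),
    expectedUtility P.seller s v ≤ expectedUtility P.seller (P.suggested v) v

/-- Individual rationality. -/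
def IsIR : Prop := ∀ v : X, 0 ≤ expectedUtility P.seller (P.suggested v) v

/-- Expected payment of type `v` under the suggested strategy. -/
noncomputable def payment (v : X) : ℝ := expectedPayment P.seller (P.suggested v)

/-- Expected revenue under the prior `D`. -/
noncomputable def revenue (D : Measure X) : ℝ := ∫ v, P.payment v ∂D

end QuantumAuctionProtocol

/-! The buyer announces a menu entry by a quantum state that the seller audits only rarely, and the
price is collected in the audit. A finite net of the menu of `M` has entries `τ j`, numbered by `m`
qubits; nothing bounds `m` in terms of `B`. Entry `j` is announced by `k` qubits, with `B ≤ 2 ^ k`,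
in the state `ψ j` whose amplitudes are the square roots of the lottery probabilities, followed by
the label `j`. After the first `k` qubits the seller, with probability `1 - ε`, measures them in the
computational basis: this samples the lottery, the bundle is free, and the label is never sent. With
probability `ε` she waits for the label and measures an observable that charges the price of sector
`j` plus a penalty for any deviation from `ψ j`, scaled up by `1 / ε`. Since `ε` may depend on `m`,
the expected communication stays below `2 * k + 1`.

Truthfulness towards the audit: a state deviating from `ψ j` gains at most a small amount beyond its
penalty (`sum_mul_normSq_le`), so a best response is worth nearly as much as a mixture of menu
entries. Menu prices carry a discount factor `1 - γ`, which makes dear entries relatively more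
attractive; with incentive compatibility of `M`, this turns near-optimality into a lower bound on
the payment (`Mechanism.exists_approximating_protocol`).

Exact incentive compatibility is obtained by suggesting an exactly optimal state, which exists by
compactness. Entangled memories, intermediate measurements and early termination do not beat the
best pure state: this is weak duality (`expectation_le_of_dual`), with observables on the seller's
memory as a certificate. The certificate is diagonal, so the conditions become scalar inequalities
(`RegisterAuction.expectation_le`). The same duality gives termination with probability one and the
bound on the qubits. That the suggested strategy attains the optimum is a direct computation of the
run (`RegisterAuction.sender_expectation`). -/

section

open scoped ComplexOrder

/-! ### Expectation values -/

/-- The real part of the expectation of the observable `O` in the (unnormalized) state `ρ`. -/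
def obsValue {ι : Type} [Fintype ι] (O ρ : Matrix ι ι ℂ) : ℝ := (O * ρ).trace.re

section ObsValue

variable {ι : Type} [Fintype ι]

theorem obsValue_nonneg {O ρ : Matrix ι ι ℂ} (hO : O.PosSemidef) (hρ : ρ.PosSemidef) :
    0 ≤ obsValue O ρ := by
  obtain ⟨m, v, rfl⟩ := Matrix.posSemidef_iff_eq_sum_vecMulVec.mp hρ
  rw [obsValue, Finset.mul_sum, Matrix.trace_sum, Complex.re_sum]
  refine Finset.sum_nonneg fun i _ => ?_
  rw [Matrix.mul_vecMulVec, Matrix.trace_vecMulVec, dotProduct_comm]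
  exact (Complex.le_def.mp (hO.dotProduct_mulVec_nonneg (v i))).1

theorem obsValue_sub (O O' ρ : Matrix ι ι ℂ) :
    obsValue (O - O') ρ = obsValue O ρ - obsValue O' ρ := by
  simp [obsValue, Matrix.sub_mul]

theorem obsValue_sum {κ : Type*} (s : Finset κ) (O : κ → Matrix ι ι ℂ) (ρ : Matrix ι ι ℂ) :
    obsValue (∑ i ∈ s, O i) ρ = ∑ i ∈ s, obsValue (O i) ρ := by
  simp [obsValue, Finset.sum_mul, Matrix.trace_sum]

theorem obsValue_smul (c : ℝ) (O ρ : Matrix ι ι ℂ) :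
    obsValue ((c : ℂ) • O) ρ = c * obsValue O ρ := by
  simp [obsValue]

theorem obsValue_zero_right (O : Matrix ι ι ℂ) : obsValue O 0 = 0 := by simp [obsValue]

theorem obsValue_one [DecidableEq ι] (ρ : Matrix ι ι ℂ) : obsValue 1 ρ = ρ.trace.re := by
  simp [obsValue]

theorem obsValue_applyOp (O A ρ : Matrix ι ι ℂ) :
    obsValue O (applyOp A ρ) = obsValue (Aᴴ * O * A) ρ := by
  rw [obsValue, obsValue, applyOp, ← Matrix.mul_assoc, Matrix.trace_mul_comm]
  simp only [Matrix.mul_assoc]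

theorem obsValue_mono {O O' ρ : Matrix ι ι ℂ} (h : (O' - O).PosSemidef) (hρ : ρ.PosSemidef) :
    obsValue O ρ ≤ obsValue O' ρ := by
  have := obsValue_nonneg h hρ
  rw [obsValue_sub] at this
  linarith

end ObsValue

theorem applyOp_posSemidef {ι : Type} [Fintype ι] {A ρ : Matrix ι ι ℂ} (h : ρ.PosSemidef) :
    (applyOp A ρ).PosSemidef :=
  h.mul_mul_conjTranspose_same A

theorem Measurement.kraus_of_le {ι : Type} [Fintype ι] [DecidableEq ι] (A : Measurement ι) {x : ℕ}
    (h : A.num ≤ x) : A.kraus x = 0 := by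
  simp [Measurement.kraus, Nat.not_lt.mpr h]

theorem Measurement.sum_kraus {ι : Type} [Fintype ι] [DecidableEq ι] (A : Measurement ι) :
    ∑ x ∈ Finset.range A.num, (A.kraus x)ᴴ * A.kraus x = 1 := by
  rw [Finset.sum_range, ← A.complete]
  refine Finset.sum_congr rfl fun i _ => ?_
  simp [Measurement.kraus]

/-! ### Local operators on the joint system -/

section LocalOperators

variable {a b : ℕ}

theorem onSeller_mul (A B : Matrix (Reg a × Fin 2) (Reg a × Fin 2) ℂ) :
    onSeller b (A * B) = onSeller b A * onSeller b B := by
  rw [onSeller, onSeller, onSeller, Matrix.submatrix_mul_equiv, ← Matrix.mul_kronecker_mul,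
    Matrix.one_mul]

theorem onSeller_conjTranspose (A : Matrix (Reg a × Fin 2) (Reg a × Fin 2) ℂ) :
    (onSeller b A)ᴴ = onSeller b Aᴴ := by
  simp [onSeller, Matrix.conjTranspose_submatrix, Matrix.conjTranspose_kronecker]

theorem onSeller_one : onSeller b (1 : Matrix (Reg a × Fin 2) (Reg a × Fin 2) ℂ) = 1 := by
  simp [onSeller]

theorem onSeller_smul (c : ℂ) (A : Matrix (Reg a × Fin 2) (Reg a × Fin 2) ℂ) :
    onSeller b (c • A) = c • onSeller b A := by
  simp [onSeller, Matrix.smul_kronecker, Matrix.submatrix_smul]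

theorem onSeller_sub (A B : Matrix (Reg a × Fin 2) (Reg a × Fin 2) ℂ) :
    onSeller b (A - B) = onSeller b A - onSeller b B := by
  ext i j
  simp [onSeller, sub_mul]

theorem onSeller_sum {κ : Type*} (s : Finset κ)
    (A : κ → Matrix (Reg a × Fin 2) (Reg a × Fin 2) ℂ) :
    onSeller b (∑ i ∈ s, A i) = ∑ i ∈ s, onSeller b (A i) := by
  ext i j
  simp [onSeller, Matrix.sum_apply, Finset.sum_mul]

theorem onSeller_posSemidef {A : Matrix (Reg a × Fin 2) (Reg a × Fin 2) ℂ} (h : A.PosSemidef) :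
    (onSeller b A).PosSemidef :=
  (h.kronecker Matrix.PosSemidef.one).submatrix _

theorem onBuyer_conjTranspose (B : Matrix (Fin 2 × Reg b) (Fin 2 × Reg b) ℂ) :
    (onBuyer a B)ᴴ = onBuyer a Bᴴ := by
  simp [onBuyer, Matrix.conjTranspose_kronecker]

/-- An operator on the seller's private qubits, acting trivially on the travelling one. -/
abbrev onMemory (R : Matrix (Reg a) (Reg a) ℂ) : Matrix (Reg a × Fin 2) (Reg a × Fin 2) ℂ :=
  R ⊗ₖ (1 : Matrix (Fin 2) (Fin 2) ℂ)

theorem onSeller_onMemory (R : Matrix (Reg a) (Reg a) ℂ) :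
    onSeller b (onMemory R) = R ⊗ₖ (1 : Matrix (Fin 2 × Reg b) (Fin 2 × Reg b) ℂ) := by
  rw [onSeller, onMemory, Matrix.kronecker_assoc', Matrix.one_kronecker_one]

/-- No signalling: the observable is trivial on the buyer's qubits, so his operators only contribute
their completeness relation. This is the only restriction on the buyer that the duality argument
uses. -/
theorem sum_onBuyer_conj (B : Measurement (Fin 2 × Reg b)) (R : Matrix (Reg a) (Reg a) ℂ) :
    ∑ y ∈ Finset.range B.num,
      (onBuyer a (B.kraus y))ᴴ * onSeller b (onMemory R) * onBuyer a (B.kraus y)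
        = onSeller b (onMemory R) := by
  have h : ∀ y, (onBuyer a (B.kraus y))ᴴ * onSeller b (onMemory R) * onBuyer a (B.kraus y)
      = R ⊗ₖ ((B.kraus y)ᴴ * B.kraus y) := fun y => by
    rw [onBuyer_conjTranspose, onSeller_onMemory, onBuyer, onBuyer, ← Matrix.mul_kronecker_mul,
      ← Matrix.mul_kronecker_mul, Matrix.one_mul, Matrix.mul_one, Matrix.mul_one]
  rw [Finset.sum_congr rfl fun y _ => h y, onSeller_onMemory, ← B.sum_kraus]
  ext i j
  simp [Matrix.sum_apply, Finset.mul_sum]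

end LocalOperators

/-! ### Expectations of terminating protocols as finite sums -/

section Run

variable {n : ℕ} (σ : SellerStrategy n) (s : BuyerStrategy)

theorem stateAfter_posSemidef (h : List (ℕ × ℕ)) : (stateAfter σ s h).PosSemidef := by
  induction h with
  | nil =>
    have h1 : initialState σ.mem s.mem = Matrix.diagonal (Pi.single 0 1) := by
      rw [initialState, Matrix.diagonal_single]
    rw [stateAfter, h1]
    refine Matrix.PosSemidef.diagonal fun i => ?_
    rw [Pi.single_apply]
    split_ifs <;> simp
  | cons p h ih =>
    obtain ⟨x, y⟩ := p
    rw [stateAfter]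
    split_ifs
    · exact Matrix.PosSemidef.zero
    · exact applyOp_posSemidef (applyOp_posSemidef ih)

/-- The histories of `t` complete rounds in which all outcomes are outcomes of the respective
measurements. -/
def histories : ℕ → Finset (List (ℕ × ℕ))
  | 0 => {[]}
  | t + 1 => (histories t).biUnion fun h =>
      (Finset.range (σ.meas (h.map Prod.fst)).num ×ˢ
        Finset.range (s.meas (h.map Prod.snd)).num).image (· :: h)

theorem sum_histories_succ (t : ℕ) (G : List (ℕ × ℕ) → ℝ) :
    ∑ h ∈ histories σ s (t + 1), G h = ∑ h ∈ histories σ s t,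
      ∑ x ∈ Finset.range (σ.meas (h.map Prod.fst)).num,
        ∑ y ∈ Finset.range (s.meas (h.map Prod.snd)).num, G ((x, y) :: h) := by
  rw [histories, Finset.sum_biUnion]
  · refine Finset.sum_congr rfl fun h _ => ?_
    rw [Finset.sum_image, Finset.sum_product]
    intro p _ q _ hpq
    exact (List.cons.inj hpq).1
  · intro h _ h' _ hne
    rw [Function.onFun, Finset.disjoint_left]
    intro l hl hl'
    obtain ⟨p, -, rfl⟩ := Finset.mem_image.mp hl
    obtain ⟨q, -, hq⟩ := Finset.mem_image.mp hl'
    exact hne (List.cons.inj hq).2.symm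

theorem length_of_mem_histories {t : ℕ} {h : List (ℕ × ℕ)} (hh : h ∈ histories σ s t) :
    h.length = t := by
  induction t generalizing h with
  | zero => simp [histories] at hh; simp [hh]
  | succ t ih =>
    obtain ⟨h', hh', hm⟩ := Finset.mem_biUnion.mp hh
    obtain ⟨p, -, rfl⟩ := Finset.mem_image.mp hm
    simp [ih hh']

theorem sellerStep_of_le {h : List ℕ} {x : ℕ} (hx : (σ.meas h).num ≤ x)
    (ρ : Matrix (Sys σ.mem s.mem) (Sys σ.mem s.mem) ℂ) : sellerStep σ s h x ρ = 0 := by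
  simp [sellerStep, Measurement.kraus_of_le _ hx, applyOp, onSeller]

theorem buyerStep_of_le {h : List ℕ} {y : ℕ} (hy : (s.meas h).num ≤ y)
    (ρ : Matrix (Sys σ.mem s.mem) (Sys σ.mem s.mem) ℂ) : buyerStep σ s h y ρ = 0 := by
  simp [buyerStep, Measurement.kraus_of_le _ hy, applyOp, onBuyer]

theorem sellerStep_zero (h : List ℕ) (x : ℕ) : sellerStep σ s h x 0 = 0 := by
  simp [sellerStep, applyOp]

theorem buyerStep_zero (h : List ℕ) (y : ℕ) : buyerStep σ s h y 0 = 0 := by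
  simp [buyerStep, applyOp]

theorem mem_histories_of_stateAfter_ne_zero {h : List (ℕ × ℕ)} (hh : stateAfter σ s h ≠ 0) :
    h ∈ histories σ s h.length := by
  induction h with
  | nil => simp [histories]
  | cons p h ih =>
    obtain ⟨x, y⟩ := p
    rw [stateAfter] at hh
    split_ifs at hh with hq
    · exact absurd rfl hh
    · refine Finset.mem_biUnion.mpr ⟨h, ih ?_, Finset.mem_image.mpr ⟨(x, y), ?_, rfl⟩⟩
      · rintro h0
        rw [h0, sellerStep_zero, buyerStep_zero] at hh
        exact hh rfl
      · rw [Finset.mem_product, Finset.mem_range, Finset.mem_range]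
        constructor
        · by_contra hx
          rw [sellerStep_of_le σ s (not_lt.mp hx), buyerStep_zero] at hh
          exact hh rfl
        · by_contra hy
          rw [buyerStep_of_le σ s (not_lt.mp hy)] at hh
          exact hh rfl

/-- The contribution to the expectation of `φ` of the round that follows the complete rounds
`h`. -/
noncomputable def roundValue (φ : Ending → ℝ) (h : List (ℕ × ℕ)) : ℝ :=
  ∑ x ∈ Finset.range (σ.meas (h.map Prod.fst)).num,
    (endProb σ s (h, x, none) * φ (h, x, none) +
      ∑ y ∈ Finset.range (s.meas (h.map Prod.snd)).num,
        endProb σ s (h, x, some y) * φ (h, x, some y))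

theorem endProb_nonneg (e : Ending) : 0 ≤ endProb σ s e := by
  obtain ⟨h, x, _ | y⟩ := e
  all_goals
    rw [endProb]
    split_ifs
    · refine (Complex.le_def.mp (Matrix.PosSemidef.trace_nonneg ?_)).1
      first
        | exact applyOp_posSemidef (stateAfter_posSemidef σ s h)
        | exact applyOp_posSemidef (applyOp_posSemidef (stateAfter_posSemidef σ s h))
    · exact le_rfl

/-- The endings that occur in at most `T + 1` rounds with outcomes of the measurements. -/
def endings (T : ℕ) : Finset Ending :=
  ((Finset.range (T + 1)).biUnion (histories σ s)).biUnion fun h =>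
    ({h} : Finset _) ×ˢ (Finset.range (σ.meas (h.map Prod.fst)).num ×ˢ
      Finset.insertNone (Finset.range (s.meas (h.map Prod.snd)).num))

/-- Labels out of range have Kraus operator `0`, and no state survives beyond `T` rounds. So every
expectation is a finite sum, and questions of summability disappear. -/
theorem endProb_eq_zero_of_notMem_endings {T : ℕ}
    (hT : ∀ h : List (ℕ × ℕ), T < h.length → stateAfter σ s h = 0) {e : Ending}
    (he : e ∉ endings σ s T) : endProb σ s e = 0 := by
  by_contra hne
  obtain ⟨h, x, o⟩ := e
  have hs : stateAfter σ s h ≠ 0 := by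
    intro h0
    apply hne
    cases o <;> simp [endProb, h0, sellerStep_zero, buyerStep_zero]
  have hx : x < (σ.meas (h.map Prod.fst)).num := by
    by_contra hx
    apply hne
    cases o <;> simp [endProb, sellerStep_of_le σ s (not_lt.mp hx), buyerStep_zero]
  refine he (Finset.mem_biUnion.mpr ⟨h, Finset.mem_biUnion.mpr ⟨h.length, ?_,
    mem_histories_of_stateAfter_ne_zero σ s hs⟩, ?_⟩)
  · rw [Finset.mem_range, Nat.lt_succ_iff]
    by_contra hl
    exact hs (hT h (not_le.mp hl))
  · simp only [Finset.mem_product, Finset.mem_singleton, true_and, Finset.mem_range]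
    refine ⟨hx, ?_⟩
    cases o with
    | none => exact Finset.none_mem_insertNone
    | some y =>
      rw [Finset.some_mem_insertNone, Finset.mem_range]
      by_contra hy
      apply hne
      simp [endProb, buyerStep_of_le σ s (not_lt.mp hy)]

theorem sum_endings (T : ℕ) (φ : Ending → ℝ) :
    ∑ e ∈ endings σ s T, endProb σ s e * φ e
      = ∑ t ∈ Finset.range (T + 1), ∑ h ∈ histories σ s t, roundValue σ s φ h := by
  rw [endings, Finset.sum_biUnion, Finset.sum_biUnion]
  · refine Finset.sum_congr rfl fun t _ => Finset.sum_congr rfl fun h _ => ?_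
    rw [Finset.sum_product, Finset.sum_singleton, Finset.sum_product, roundValue]
    exact Finset.sum_congr rfl fun x _ => Finset.sum_insertNone _ _
  · intro t _ t' _ hne
    rw [Function.onFun, Finset.disjoint_left]
    intro h hh hh'
    exact hne ((length_of_mem_histories σ s hh).symm.trans (length_of_mem_histories σ s hh'))
  · intro h _ h' _ hne
    rw [Function.onFun, Finset.disjoint_left]
    intro e he he'
    simp only [Finset.mem_product, Finset.mem_singleton] at he he'
    exact hne (he.1.symm.trans he'.1)

theorem hasSum_endProb_mul {T : ℕ}
    (hT : ∀ h : List (ℕ × ℕ), T < h.length → stateAfter σ s h = 0) (φ : Ending → ℝ) :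
    HasSum (fun e => endProb σ s e * φ e) (∑ e ∈ endings σ s T, endProb σ s e * φ e) :=
  hasSum_sum_of_ne_finset_zero fun e he => by
    rw [endProb_eq_zero_of_notMem_endings σ s hT he, zero_mul]

/-- A potential that in each round drops by at least the expected contribution of the round bounds
the total expectation. -/
theorem sum_endings_le_of_potential {T : ℕ}
    (hT : ∀ h : List (ℕ × ℕ), T < h.length → stateAfter σ s h = 0) (φ : Ending → ℝ)
    (G : List (ℕ × ℕ) → ℝ) (hG0 : ∀ h, stateAfter σ s h = 0 → 0 ≤ G h)
    (hG : ∀ h : List (ℕ × ℕ), h.length ≤ T → roundValue σ s φ h +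
      ∑ x ∈ Finset.range (σ.meas (h.map Prod.fst)).num,
        ∑ y ∈ Finset.range (s.meas (h.map Prod.snd)).num, G ((x, y) :: h) ≤ G h) :
    ∑ e ∈ endings σ s T, endProb σ s e * φ e ≤ G [] := by
  rw [sum_endings]
  have key : ∀ t ≤ T + 1, ∑ i ∈ Finset.range t, ∑ h ∈ histories σ s i, roundValue σ s φ h +
      ∑ h ∈ histories σ s t, G h ≤ G [] := by
    intro t
    induction t with
    | zero => intro _; simp [histories]
    | succ t ih =>
      intro ht
      refine le_trans ?_ (ih (by omega))
      rw [Finset.sum_range_succ, sum_histories_succ, add_assoc, ← Finset.sum_add_distrib]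
      gcongr with h hh
      exact hG h (by rw [length_of_mem_histories σ s hh]; omega)
  -- The telescoped inequality keeps the potential of the histories of length `T + 1`; their states
  -- vanish, so this remainder is nonnegative.
  refine le_trans (le_add_of_nonneg_right (Finset.sum_nonneg fun h hh => hG0 h (hT h ?_)))
    (key (T + 1) le_rfl)
  rw [length_of_mem_histories σ s hh]
  omega

/-- The payoff that is `f` of the seller's history if she terminates, and `g` if the buyer does. -/
def historyPayoff (f g : List ℕ → ℝ) : Ending → ℝ
  | (h, x, none) => f (x :: h.map Prod.fst)
  | (h, x, some _) => g (x :: h.map Prod.fst)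

theorem historyPayoff_self (f : List ℕ → ℝ) (e : Ending) :
    historyPayoff f f e = f e.sellerHistory := by
  obtain ⟨h, x, _ | y⟩ := e <;> rfl

theorem sellerStep_value (h : List ℕ) (x : ℕ)
    (O : Matrix (Reg σ.mem × Fin 2) (Reg σ.mem × Fin 2) ℂ)
    (ρ : Matrix (Sys σ.mem s.mem) (Sys σ.mem s.mem) ℂ) :
    obsValue (onSeller s.mem O) (sellerStep σ s h x ρ)
      = obsValue (onSeller s.mem (((σ.meas h).kraus x)ᴴ * O * (σ.meas h).kraus x)) ρ := by
  rw [sellerStep, obsValue_applyOp, onSeller_conjTranspose, ← onSeller_mul, ← onSeller_mul]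

theorem sum_buyerStep_value (h : List ℕ) (R : Matrix (Reg σ.mem) (Reg σ.mem) ℂ)
    (ρ : Matrix (Sys σ.mem s.mem) (Sys σ.mem s.mem) ℂ) :
    ∑ y ∈ Finset.range (s.meas h).num,
      obsValue (onSeller s.mem (onMemory R)) (buyerStep σ s h y ρ)
      = obsValue (onSeller s.mem (onMemory R)) ρ := by
  conv_rhs => rw [← sum_onBuyer_conj (s.meas h) R, obsValue_sum]
  exact Finset.sum_congr rfl fun y _ => by rw [buyerStep, obsValue_applyOp]

theorem obsValue_initialState (a b : ℕ) (R : Matrix (Reg a) (Reg a) ℂ) :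
    obsValue (onSeller b (onMemory R)) (initialState a b) = (R 0 0).re := by
  rw [obsValue, onSeller_onMemory, initialState, Matrix.trace_mul_single]
  simp [Matrix.kroneckerMap_apply]

/-- Weak duality: a family of observables on the seller's memory that dominates her payoffs bounds
the expected payoff against every strategy of the buyer. -/
theorem expectation_le_of_dual {T : ℕ}
    (hT : ∀ h : List (ℕ × ℕ), T < h.length → stateAfter σ s h = 0) (f g : List ℕ → ℝ)
    (R : List ℕ → Matrix (Reg σ.mem) (Reg σ.mem) ℂ)
    (hR : ∀ h : List ℕ, h.length ≤ T → (onMemory (R h) -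
      ∑ x ∈ Finset.range (σ.meas h).num, ((σ.meas h).kraus x)ᴴ *
        (if σ.halt (x :: h) then (f (x :: h) : ℂ) • 1 else onMemory (R (x :: h))) *
          (σ.meas h).kraus x).PosSemidef)
    (hg : ∀ (h : List ℕ) (x : ℕ), h.length ≤ T → x < (σ.meas h).num → σ.halt (x :: h) = false →
      (R (x :: h) - (g (x :: h) : ℂ) • 1).PosSemidef) :
    ∑ e ∈ endings σ s T, endProb σ s e * historyPayoff f g e ≤ (R [] 0 0).re := by
  have h0 := sum_endings_le_of_potential σ s hT (historyPayoff f g)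
    (fun h => obsValue (onSeller s.mem (onMemory (R (h.map Prod.fst)))) (stateAfter σ s h))
    (fun h hh => by rw [hh, obsValue_zero_right]) ?_
  · simpa [stateAfter, obsValue_initialState] using h0
  intro h hl
  have hl' : (h.map Prod.fst).length ≤ T := by simpa using hl
  have hρ := stateAfter_posSemidef σ s h
  have hstep := obsValue_mono (ρ := stateAfter σ s h)
    (by rw [← onSeller_sub]; exact onSeller_posSemidef (b := s.mem) (hR _ hl')) hρ
  refine le_trans ?_ hstep
  rw [onSeller_sum, obsValue_sum, roundValue, ← Finset.sum_add_distrib]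
  refine Finset.sum_le_sum fun x hx => ?_
  rw [← sellerStep_value]
  have hρ' : (sellerStep σ s (h.map Prod.fst) x (stateAfter σ s h)).PosSemidef :=
    applyOp_posSemidef hρ
  by_cases hh : σ.halt (x :: h.map Prod.fst)
  · simp only [endProb, historyPayoff, hh, stateAfter, if_true, Bool.true_or, Bool.not_true,
      Bool.false_and, obsValue_zero_right, Finset.sum_const_zero, zero_mul, Bool.false_eq_true,
      if_false, add_zero]
    rw [onSeller_smul, onSeller_one, obsValue_smul, obsValue_one, mul_comm]
  · simp only [Bool.not_eq_true] at hh
    simp only [endProb, historyPayoff, hh, stateAfter, Bool.false_or, Bool.not_false,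
      Bool.true_and, zero_mul, Bool.false_eq_true, if_false, zero_add]
    -- The potential after the seller's step splits over the buyer's outcomes without loss. Each
    -- share is then the potential of the next round, or it dominates the payoff `g` if he quits.
    rw [← Finset.sum_add_distrib, ← sum_buyerStep_value]
    refine Finset.sum_le_sum fun y _ => ?_
    by_cases hq : s.quit (y :: h.map Prod.snd)
    · simp only [hq, if_true, obsValue_zero_right, add_zero]
      have hp := obsValue_mono (ρ := buyerStep σ s (h.map Prod.snd) y
          (sellerStep σ s (h.map Prod.fst) x (stateAfter σ s h)))
        (O := onSeller s.mem (onMemory ((g (x :: h.map Prod.fst) : ℂ) • 1)))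
        (O' := onSeller s.mem (onMemory (R (x :: h.map Prod.fst)))) ?_ (applyOp_posSemidef hρ')
      · refine le_trans (le_of_eq ?_) hp
        rw [onMemory, Matrix.smul_kronecker, Matrix.one_kronecker_one, onSeller_smul, onSeller_one,
          obsValue_smul, obsValue_one, mul_comm]
      · rw [← onSeller_sub]
        refine onSeller_posSemidef ?_
        have heq : onMemory (R (x :: h.map Prod.fst)) -
            onMemory ((g (x :: h.map Prod.fst) : ℂ) • 1) =
            (R (x :: h.map Prod.fst) - (g (x :: h.map Prod.fst) : ℂ) • 1) ⊗ₖ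
              (1 : Matrix (Fin 2) (Fin 2) ℂ) := by
          ext i j
          simp [onMemory, sub_mul]
        rw [heq]
        exact (hg _ x hl' (Finset.mem_range.mp hx) hh).kronecker Matrix.PosSemidef.one
    · simp [hq]

end Run

/-! ### Measurements with labelled outcomes -/

/-- The squared norm of a vector of amplitudes. -/
noncomputable def ampNormSq {ι : Type} [Fintype ι] (Ψ : ι → ℂ) : ℝ := ∑ z, Complex.normSq (Ψ z)

theorem star_dotProduct_self {ι : Type} [Fintype ι] (Ψ : ι → ℂ) :
    star Ψ ⬝ᵥ Ψ = (ampNormSq Ψ : ℂ) := by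
  simp [dotProduct, ampNormSq, Complex.normSq_eq_conj_mul_self]

theorem star_dotProduct_conjTranspose_mul_mulVec {ι : Type} [Fintype ι] (A : Matrix ι ι ℂ)
    (Ψ : ι → ℂ) : star Ψ ⬝ᵥ ((Aᴴ * A) *ᵥ Ψ) = (ampNormSq (A *ᵥ Ψ) : ℂ) := by
  rw [← star_dotProduct_self, Matrix.star_mulVec, ← Matrix.mulVec_mulVec,
    Matrix.dotProduct_mulVec]

theorem star_dotProduct_diagonal_mulVec {ι : Type} [Fintype ι] [DecidableEq ι] (d : ι → ℝ)
    (Ψ : ι → ℂ) : star Ψ ⬝ᵥ (Matrix.diagonal (fun z => (d z : ℂ)) *ᵥ Ψ)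
      = ((∑ z, d z * Complex.normSq (Ψ z) : ℝ) : ℂ) := by
  simp only [dotProduct, Matrix.mulVec_diagonal, Pi.star_apply, Complex.ofReal_sum,
    Complex.ofReal_mul, Complex.normSq_eq_conj_mul_self]
  exact Finset.sum_congr rfl fun z _ => by simp only [RCLike.star_def]; ring

/-- The outcome label that a natural number stands for; numbers out of range stand for `none`. -/
noncomputable def decodeOutcome (κ : Type) [Fintype κ] (x : ℕ) : Option κ :=
  if h : x < Fintype.card (Option κ) then (Fintype.equivFin (Option κ)).symm ⟨x, h⟩ else none

theorem sum_range_decodeOutcome {κ : Type} [Fintype κ] {M : Type*} [AddCommMonoid M]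
    (f : Option κ → M) :
    ∑ x ∈ Finset.range (Fintype.card (Option κ)), f (decodeOutcome κ x) = ∑ o, f o := by
  rw [Finset.sum_range, ← (Fintype.equivFin (Option κ)).symm.sum_comp f]
  refine Finset.sum_congr rfl fun x _ => ?_
  rw [decodeOutcome, dif_pos x.isLt]

/-- A measurement whose outcomes are labelled by `Option κ`. -/
noncomputable def Measurement.ofLabelled {ι : Type} [Fintype ι] [DecidableEq ι]
    {κ : Type} [Fintype κ] (A : Option κ → Matrix ι ι ℂ) (hA : ∑ o, (A o)ᴴ * A o = 1) :
    Measurement ι where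
  num := Fintype.card (Option κ)
  op x := A ((Fintype.equivFin (Option κ)).symm x)
  complete := by
    rw [← hA]
    exact (Fintype.equivFin (Option κ)).symm.sum_comp fun o => (A o)ᴴ * A o

theorem Measurement.ofLabelled_kraus {ι : Type} [Fintype ι] [DecidableEq ι] {κ : Type} [Fintype κ]
    (A : Option κ → Matrix ι ι ℂ) (hA : ∑ o, (A o)ᴴ * A o = 1) {x : ℕ}
    (hx : x < Fintype.card (Option κ)) :
    (Measurement.ofLabelled A hA).kraus x = A (decodeOutcome κ x) := by
  rw [Measurement.kraus, decodeOutcome, dif_pos hx]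
  exact dif_pos hx

theorem ampNormSq_nonneg {ι : Type} [Fintype ι] (Ψ : ι → ℂ) : 0 ≤ ampNormSq Ψ :=
  Finset.sum_nonneg fun _ _ => Complex.normSq_nonneg _

theorem sum_single_conj {ι : Type} [Fintype ι] [DecidableEq ι] (f : ι → ℂ) :
    ∑ r : ι, f r • ((Matrix.single r r (1 : ℂ))ᴴ * Matrix.single r r 1) = Matrix.diagonal f := by
  simp only [Matrix.conjTranspose_single, star_one, Matrix.single_mul_single_same, mul_one]
  ext i j
  simp only [Matrix.sum_apply, Matrix.smul_apply, Matrix.single_apply, Matrix.diagonal_apply]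
  by_cases hij : i = j
  · subst hij
    simp
  · rw [if_neg hij]
    refine Finset.sum_eq_zero fun r _ => ?_
    rw [if_neg fun h => hij (h.1.symm.trans h.2), smul_zero]

theorem sqrt_smul_conj_mul {ι : Type} [Fintype ι] {c : ℝ} (hc : 0 ≤ c) (A : Matrix ι ι ℂ) :
    ((Real.sqrt c : ℂ) • A)ᴴ * ((Real.sqrt c : ℂ) • A) = (c : ℂ) • (Aᴴ * A) := by
  rw [Matrix.conjTranspose_smul, Matrix.smul_mul, Matrix.mul_smul, smul_smul]
  congr 1
  rw [RCLike.star_def, Complex.conj_ofReal, ← Complex.ofReal_mul, Real.mul_self_sqrt hc]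

/-! ### Receiving qubits -/

/-- Exchange of the travelling qubit with the private qubit `i`. -/
def swapWith {L : ℕ} (i : Fin L) : Equiv.Perm (Reg L × Fin 2) :=
  Function.Involutive.toPerm (fun p => (Function.update p.1 i p.2, p.1 i)) fun p => by simp

theorem swapWith_apply {L : ℕ} (i : Fin L) (p : Reg L × Fin 2) :
    swapWith i p = (Function.update p.1 i p.2, p.1 i) := rfl

/-- On her turn after `t ≥ 1` rounds the seller puts the travelling qubit into place `t - 1`. -/
def receivePerm (L t : ℕ) : Equiv.Perm (Reg L × Fin 2) :=
  if h : 1 ≤ t ∧ t ≤ L then swapWith ⟨t - 1, by omega⟩ else 1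

/-- The unitary that puts the travelling qubit into place. -/
noncomputable def receiveOp (L t : ℕ) : Matrix (Reg L × Fin 2) (Reg L × Fin 2) ℂ :=
  (receivePerm L t).permMatrix ℂ

theorem permMatrix_conjTranspose_mul_self {ι : Type} [Fintype ι] [DecidableEq ι]
    (π : Equiv.Perm ι) : (π.permMatrix ℂ)ᴴ * π.permMatrix ℂ = 1 := by
  rw [Matrix.conjTranspose_permMatrix, ← Matrix.permMatrix_mul, mul_inv_cancel,
    Matrix.permMatrix_one]

theorem permMatrix_conj_diagonal {ι : Type} [Fintype ι] [DecidableEq ι]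
    (π : Equiv.Perm ι) (d : ι → ℂ) (hd : ∀ i, d (π i) = d i) :
    (π.permMatrix ℂ)ᴴ * Matrix.diagonal d * π.permMatrix ℂ = Matrix.diagonal d := by
  have h : Matrix.diagonal d * π.permMatrix ℂ = π.permMatrix ℂ * Matrix.diagonal d := by
    ext i j
    rw [Matrix.diagonal_mul, Matrix.mul_diagonal]
    by_cases hij : π i = j
    · rw [← hij, hd, mul_comm]
    · have h0 : π.permMatrix ℂ i j = 0 := by
        simp [Equiv.Perm.permMatrix, PEquiv.toMatrix_apply, hij]
      rw [h0, mul_zero, zero_mul]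
  rw [Matrix.mul_assoc, h, ← Matrix.mul_assoc, permMatrix_conjTranspose_mul_self, Matrix.one_mul]

theorem onMemory_diagonal {L : ℕ} (d : Reg L → ℂ) :
    onMemory (Matrix.diagonal d) = Matrix.diagonal fun p : Reg L × Fin 2 => d p.1 := by
  rw [onMemory, ← Matrix.diagonal_one, Matrix.diagonal_kronecker_diagonal]
  simp

theorem onMemory_mul {L : ℕ} (A B : Matrix (Reg L) (Reg L) ℂ) :
    onMemory (A * B) = onMemory A * onMemory B := by
  simp [onMemory, ← Matrix.mul_kronecker_mul]

theorem onMemory_conjTranspose {L : ℕ} (A : Matrix (Reg L) (Reg L) ℂ) :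
    (onMemory A)ᴴ = onMemory Aᴴ := by
  simp [onMemory, Matrix.conjTranspose_kronecker]

theorem onMemory_sum {L : ℕ} {κ : Type*} (s : Finset κ) (A : κ → Matrix (Reg L) (Reg L) ℂ) :
    onMemory (∑ o ∈ s, A o) = ∑ o ∈ s, onMemory (A o) := by
  ext i j
  simp [onMemory, Matrix.sum_apply, Finset.sum_mul]

theorem onMemory_sub {L : ℕ} (A B : Matrix (Reg L) (Reg L) ℂ) :
    onMemory (A - B) = onMemory A - onMemory B := by
  ext i j
  simp [onMemory, sub_mul]

theorem onMemory_smul {L : ℕ} (c : ℂ) (A : Matrix (Reg L) (Reg L) ℂ) :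
    onMemory (c • A) = c • onMemory A := by
  simp [onMemory, Matrix.smul_kronecker]

theorem onMemory_one {L : ℕ} : onMemory (1 : Matrix (Reg L) (Reg L) ℂ) = 1 := by
  simp [onMemory]

/-! ### The seller's protocol -/

/-- Parameters of an auction in which the buyer sends a register of `len` qubits, one by one. After
`cut` of them the seller either (with probability `1 - prob`) measures what she has in the
computational basis and gives away a bundle for free, or she collects the remaining qubits, performs
the measurement `test`, charges a price that depends on the outcome and gives away a fixed
bundle. -/
structure RegisterAuction (n : ℕ) where
  cut : ℕ
  len : ℕ
  cut_pos : 1 ≤ cut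
  cut_lt : cut < len
  prob : ℝ
  prob_pos : 0 < prob
  prob_le : prob ≤ 1
  bundle : Reg len → Finset (Fin n)
  bundle_congr : ∀ z z' : Reg len, (∀ i, i.val < cut → z i = z' i) → bundle z = bundle z'
  fallback : Finset (Fin n)
  test : Reg len → Matrix (Reg len) (Reg len) ℂ
  test_complete : ∑ i, (test i)ᴴ * test i = 1
  price : Reg len → ℝ
  fine : ℝ

namespace RegisterAuction

variable {n : ℕ} (Q : RegisterAuction n)

/-- The operators on the seller's memory in her turn after `t` rounds. -/
noncomputable def memoryOp (t : ℕ) : Option (Reg Q.len) → Matrix (Reg Q.len) (Reg Q.len) ℂ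
  | none => if Q.len ≤ t then 0 else if t = Q.cut then (Real.sqrt Q.prob : ℂ) • 1 else 1
  | some r => if Q.len ≤ t then Q.test r else
      if t = Q.cut then (Real.sqrt (1 - Q.prob) : ℂ) • Matrix.single r r 1 else 0

theorem sum_memoryOp (t : ℕ) (c : Option (Reg Q.len) → ℂ) :
    ∑ o, c o • ((Q.memoryOp t o)ᴴ * Q.memoryOp t o) =
      if Q.len ≤ t then ∑ r, c (some r) • ((Q.test r)ᴴ * Q.test r) else
      if t = Q.cut then Matrix.diagonal fun r => Q.prob * c none + (1 - Q.prob) * c (some r)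
      else c none • 1 := by
  rw [Fintype.sum_option]
  by_cases h1 : Q.len ≤ t
  · simp [memoryOp, h1]
  by_cases h2 : t = Q.cut
  · simp only [memoryOp, if_neg h1, if_pos h2]
    simp only [sqrt_smul_conj_mul Q.prob_pos.le, sqrt_smul_conj_mul (sub_nonneg.mpr Q.prob_le),
      smul_smul]
    rw [sum_single_conj]
    ext i j
    simp only [Matrix.conjTranspose_one, Matrix.mul_one, Matrix.add_apply, Matrix.smul_apply,
      Matrix.one_apply, Matrix.diagonal_apply]
    split_ifs
    · simp [mul_comm]
    · simp
  · simp [memoryOp, h1, h2]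

/-- The operators of the seller's measurement in her turn after `t` rounds. -/
noncomputable def turnOp (t : ℕ) (o : Option (Reg Q.len)) :
    Matrix (Reg Q.len × Fin 2) (Reg Q.len × Fin 2) ℂ :=
  onMemory (Q.memoryOp t o) * receiveOp Q.len t

theorem turnOp_conj (t : ℕ) (o : Option (Reg Q.len)) (O : Matrix (Reg Q.len) (Reg Q.len) ℂ) :
    (Q.turnOp t o)ᴴ * onMemory O * Q.turnOp t o = (receiveOp Q.len t)ᴴ *
      onMemory ((Q.memoryOp t o)ᴴ * O * Q.memoryOp t o) * receiveOp Q.len t := by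
  rw [turnOp, Matrix.conjTranspose_mul, onMemory_conjTranspose, onMemory_mul, onMemory_mul]
  simp only [Matrix.mul_assoc]

theorem sum_turnOp (t : ℕ) : ∑ o, (Q.turnOp t o)ᴴ * Q.turnOp t o = 1 := by
  have h : ∀ o, (Q.turnOp t o)ᴴ * Q.turnOp t o = (receiveOp Q.len t)ᴴ *
      onMemory ((1 : ℂ) • ((Q.memoryOp t o)ᴴ * Q.memoryOp t o)) * receiveOp Q.len t := fun o => by
    have := Q.turnOp_conj t o 1
    rwa [onMemory_one, Matrix.mul_one, Matrix.mul_one, ← one_smul ℂ ((Q.memoryOp t o)ᴴ * _)] at this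
  have h1 := Q.sum_memoryOp t fun _ => 1
  rw [Finset.sum_congr rfl fun o _ => h o, ← Finset.sum_mul, ← Finset.mul_sum, ← onMemory_sum, h1]
  have h2 : (if Q.len ≤ t then ∑ r, (1 : ℂ) • ((Q.test r)ᴴ * Q.test r) else
      if t = Q.cut then Matrix.diagonal fun _ => Q.prob * 1 + (1 - Q.prob) * 1
      else (1 : ℂ) • 1) = 1 := by
    split_ifs
    · simp [Q.test_complete]
    · simp
    · simp
  rw [h2, onMemory_one, Matrix.mul_one]
  exact permMatrix_conjTranspose_mul_self _

/-- The seller's strategy. -/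
noncomputable abbrev seller : SellerStrategy n where
  mem := Q.len
  meas h := Measurement.ofLabelled (Q.turnOp h.length) (Q.sum_turnOp h.length)
  halt
    | [] => false
    | x :: _ => (decodeOutcome (Reg Q.len) x).isSome
  alloc
    | [] => Q.fallback
    | x :: h =>
      match decodeOutcome (Reg Q.len) x with
      | none => Q.fallback
      | some r => if Q.len ≤ h.length then Q.fallback else Q.bundle r
  pay
    | [] => 0
    | x :: h =>
      match decodeOutcome (Reg Q.len) x with
      | none => Q.fine
      | some r => if Q.len ≤ h.length then Q.price r else 0

theorem seller_kraus (h : List ℕ) {x : ℕ} (hx : x < Fintype.card (Option (Reg Q.len))) :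
    (Q.seller.meas h).kraus x = Q.turnOp h.length (decodeOutcome (Reg Q.len) x) :=
  Measurement.ofLabelled_kraus _ (Q.sum_turnOp h.length) hx

/-- After `len` rounds the outcome `none` has operator `0`, so the seller certainly halts on that
turn. -/
theorem stateAfter_eq_zero (s : BuyerStrategy) (h : List (ℕ × ℕ)) (hl : Q.len < h.length) :
    stateAfter Q.seller s h = 0 := by
  induction h with
  | nil => simp at hl
  | cons p h ih =>
    obtain ⟨x, y⟩ := p
    rw [stateAfter]
    split_ifs with hq
    · rfl
    · rw [List.length_cons, Nat.lt_succ_iff] at hl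
      have hs : sellerStep Q.seller s (h.map Prod.fst) x (stateAfter Q.seller s h) = 0 := by
        by_cases hx : x < Fintype.card (Option (Reg Q.len))
        · have hn : decodeOutcome (Reg Q.len) x = none := by
            by_contra hne
            apply hq
            simp [Option.isSome_iff_ne_none.mpr hne]
          rw [sellerStep, Q.seller_kraus _ hx, hn]
          have h0 : Q.turnOp (h.map Prod.fst).length none = 0 := by
            simp [turnOp, memoryOp, hl, onMemory]
          rw [h0]
          simp [applyOp, onSeller]
        · exact sellerStep_of_le Q.seller s (not_lt.mp hx) _
      rw [hs, buyerStep_zero]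

/-- Weak duality for diagonal observables. -/
theorem expectation_le (s : BuyerStrategy) (f g : List ℕ → ℝ) (F : ℕ → Reg Q.len → ℝ)
    (hf : ∀ x h r, decodeOutcome (Reg Q.len) x = some r → f (x :: h) = F h.length r)
    (d : ℕ → Reg Q.len → ℝ)
    (hinv : ∀ (t : ℕ) (i : Fin Q.len) (z : Reg Q.len) (q : Fin 2), t = i.val + 1 →
      d t (Function.update z i q) = d t z)
    (hstep : ∀ t z, t < Q.len → t ≠ Q.cut → d (t + 1) z ≤ d t z)
    (hcut : ∀ z, Q.prob * d (Q.cut + 1) z + (1 - Q.prob) * F Q.cut z ≤ d Q.cut z)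
    (hlast : ∀ Ψ : Reg Q.len → ℂ, ∑ r, F Q.len r * ampNormSq (Q.test r *ᵥ Ψ)
      ≤ ∑ z, d Q.len z * Complex.normSq (Ψ z))
    (hquit : ∀ x h z, decodeOutcome (Reg Q.len) x = none → h.length ≤ Q.len →
      g (x :: h) ≤ d (h.length + 1) z) :
    ∑ e ∈ endings Q.seller s Q.len, endProb Q.seller s e * historyPayoff f g e ≤ d 0 0 := by
  have key := expectation_le_of_dual Q.seller s (Q.stateAfter_eq_zero s) f g
    (fun h => Matrix.diagonal fun z : Reg Q.len => (d h.length z : ℂ)) ?_ ?_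
  · rwa [Matrix.diagonal_apply_eq, Complex.ofReal_re] at key
  · intro h hl
    set t := h.length with ht
    have hsum : ∑ x ∈ Finset.range (Q.seller.meas h).num, ((Q.seller.meas h).kraus x)ᴴ *
        (if Q.seller.halt (x :: h) then (f (x :: h) : ℂ) • 1 else onMemory
          (Matrix.diagonal fun z : Reg Q.len => (d (x :: h).length z : ℂ))) *
          (Q.seller.meas h).kraus x = (receiveOp Q.len t)ᴴ * onMemory (∑ o,
          (Q.memoryOp t o)ᴴ * (match o with
            | none => Matrix.diagonal fun z : Reg Q.len => (d (t + 1) z : ℂ)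
            | some r => (F t r : ℂ) • 1) * Q.memoryOp t o) * receiveOp Q.len t := by
      rw [onMemory_sum, Finset.mul_sum, Finset.sum_mul, ← sum_range_decodeOutcome]
      refine Finset.sum_congr rfl fun x hx => ?_
      rw [Q.seller_kraus h (Finset.mem_range.mp hx), ← turnOp_conj]
      congr 2
      cases hd : decodeOutcome (Reg Q.len) x with
      | none => simp [hd, ht]
      | some r =>
        simp only [hd, Option.isSome_some, if_true, hf x h r hd]
        rw [onMemory_smul, onMemory_one]
    rw [hsum]
    -- The weight `d t` does not depend on the place filled on turn `t`, so its observable commutes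
    -- with the swap that stores the qubit.
    have hconj : onMemory (Matrix.diagonal fun z : Reg Q.len => (d t z : ℂ)) =
        (receiveOp Q.len t)ᴴ * onMemory (Matrix.diagonal fun z : Reg Q.len => (d t z : ℂ)) *
          receiveOp Q.len t := by
      rw [onMemory_diagonal, receiveOp, permMatrix_conj_diagonal]
      rintro ⟨z, q⟩
      rw [receivePerm]
      split_ifs with h1
      · rw [swapWith_apply, hinv t _ z q (by change t = t - 1 + 1; omega)]
      · rfl
    have hps : ((Matrix.diagonal fun z : Reg Q.len => (d t z : ℂ)) - ∑ o,
          (Q.memoryOp t o)ᴴ * (match o with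
            | none => Matrix.diagonal fun z : Reg Q.len => (d (t + 1) z : ℂ)
            | some r => (F t r : ℂ) • 1) * Q.memoryOp t o).PosSemidef := by
      rw [Fintype.sum_option]
      simp only [memoryOp]
      split_ifs with h1 h2
      · have htl : t = Q.len := le_antisymm hl h1
        rw [htl]
        simp only [Matrix.mul_zero, zero_add, Matrix.mul_smul, Matrix.smul_mul, Matrix.mul_one]
        refine Matrix.PosSemidef.of_dotProduct_mulVec_nonneg ?_ ?_
        · refine Matrix.IsHermitian.sub ?_ ?_
          · refine Matrix.isHermitian_diagonal_of_self_adjoint _ ?_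
            ext z
            simp
          · rw [Matrix.IsHermitian, Matrix.conjTranspose_sum]
            refine Finset.sum_congr rfl fun r _ => ?_
            simp [Matrix.conjTranspose_smul, Matrix.conjTranspose_mul]
        · intro Ψ
          rw [Matrix.sub_mulVec, dotProduct_sub, star_dotProduct_diagonal_mulVec,
            Matrix.sum_mulVec, dotProduct_sum]
          simp only [Matrix.smul_mulVec, dotProduct_smul,
            star_dotProduct_conjTranspose_mul_mulVec, smul_eq_mul]
          have := hlast Ψ
          rw [← sub_nonneg] at this
          exact_mod_cast this
      · have h3 : ∀ D : Matrix (Reg Q.len) (Reg Q.len) ℂ,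
            ((Real.sqrt Q.prob : ℂ) • (1 : Matrix (Reg Q.len) (Reg Q.len) ℂ))ᴴ * D *
              ((Real.sqrt Q.prob : ℂ) • 1) = (Q.prob : ℂ) • D := fun D => by
          rw [Matrix.conjTranspose_smul, Matrix.smul_mul, Matrix.mul_smul, Matrix.smul_mul,
            smul_smul, RCLike.star_def, Complex.conj_ofReal, ← Complex.ofReal_mul,
            Real.mul_self_sqrt Q.prob_pos.le]
          simp
        rw [h3]
        have h5 : ∀ r : Reg Q.len,
            ((Real.sqrt (1 - Q.prob) : ℂ) • Matrix.single r r (1 : ℂ))ᴴ * ((F t r : ℂ) • 1) *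
              ((Real.sqrt (1 - Q.prob) : ℂ) • Matrix.single r r (1 : ℂ)) =
            ((F t r : ℂ) * ((1 - Q.prob : ℝ) : ℂ)) •
              ((Matrix.single r r (1 : ℂ))ᴴ * Matrix.single r r 1) := fun r => by
          rw [Matrix.mul_smul _ (F t r : ℂ) (1 : Matrix _ _ ℂ), Matrix.mul_one,
            Matrix.smul_mul (F t r : ℂ), sqrt_smul_conj_mul (sub_nonneg.mpr Q.prob_le), smul_smul]
        rw [Finset.sum_congr rfl fun r _ => h5 r, sum_single_conj, ← Matrix.diagonal_smul,
          Matrix.diagonal_add, Matrix.diagonal_sub]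
        refine Matrix.PosSemidef.diagonal fun z => ?_
        have := hcut z
        rw [← h2, ← sub_nonneg] at this
        have h4 : (d t z : ℂ) - (((Q.prob : ℂ) • fun z => (d (t + 1) z : ℂ)) z +
            (F t z : ℂ) * ((1 - Q.prob : ℝ) : ℂ)) =
            ((d t z - (Q.prob * d (t + 1) z + (1 - Q.prob) * F t z) : ℝ) : ℂ) := by
          simp
          ring
        change (0 : ℂ) ≤ _
        rw [h4]
        exact_mod_cast this
      · simp only [Matrix.conjTranspose_one, Matrix.one_mul, Matrix.mul_one, Matrix.mul_zero,
          Finset.sum_const_zero, add_zero]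
        rw [Matrix.diagonal_sub]
        refine Matrix.PosSemidef.diagonal fun z => ?_
        have := hstep t z (not_le.mp h1) h2
        rw [← sub_nonneg] at this
        change (0 : ℂ) ≤ _
        exact_mod_cast this
    rw [hconj, ← Matrix.sub_mul, ← Matrix.mul_sub, ← onMemory_sub]
    exact (hps.kronecker Matrix.PosSemidef.one).conjTranspose_mul_mul_same _
  · intro h x hl _ hh
    have hd : decodeOutcome (Reg Q.len) x = none := by
      simpa using hh
    rw [Matrix.smul_one_eq_diagonal, Matrix.diagonal_sub]
    refine Matrix.PosSemidef.diagonal fun z => ?_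
    have := hquit x h z hd hl
    rw [← sub_nonneg] at this
    change (0 : ℂ) ≤ _
    rw [List.length_cons]
    exact_mod_cast this

end RegisterAuction

/-! ### Bounds against every strategy of the buyer -/

namespace RegisterAuction

variable {n : ℕ} (Q : RegisterAuction n)

theorem sum_ampNormSq_test (Ψ : Reg Q.len → ℂ) :
    ∑ r, ampNormSq (Q.test r *ᵥ Ψ) = ampNormSq Ψ := by
  have h : ((∑ r, ampNormSq (Q.test r *ᵥ Ψ) : ℝ) : ℂ) = (ampNormSq Ψ : ℂ) := by
    rw [Complex.ofReal_sum]
    simp only [← star_dotProduct_conjTranspose_mul_mulVec]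
    rw [← dotProduct_sum, ← Matrix.sum_mulVec, Q.test_complete, Matrix.one_mulVec,
      star_dotProduct_self]
  exact_mod_cast h

/-- Expected utility of a buyer of type `v` who sends the register in the state `Ψ`. -/
noncomputable def stateUtility (v : BundleValuation n) (Ψ : Reg Q.len → ℂ) : ℝ :=
  (1 - Q.prob) * ∑ z, v (Q.bundle z) * Complex.normSq (Ψ z) +
    Q.prob * ∑ r, (v Q.fallback - Q.price r) * ampNormSq (Q.test r *ᵥ Ψ)

/-- Expected payment of a buyer who sends the register in the state `Ψ`. -/
noncomputable def statePayment (Ψ : Reg Q.len → ℂ) : ℝ :=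
  Q.prob * ∑ r, Q.price r * ampNormSq (Q.test r *ᵥ Ψ)

theorem hasSum_endProb_mul_sellerHistory (s : BuyerStrategy) (f : List ℕ → ℝ) :
    HasSum (fun e : Ending => endProb Q.seller s e * f e.sellerHistory)
      (∑ e ∈ endings Q.seller s Q.len, endProb Q.seller s e * historyPayoff f f e) := by
  simp only [historyPayoff_self]
  exact hasSum_endProb_mul Q.seller s (Q.stateAfter_eq_zero s) fun e => f e.sellerHistory

theorem sum_endProb_const (s : BuyerStrategy) (c : ℝ) :
    ∑ e ∈ endings Q.seller s Q.len, endProb Q.seller s e * historyPayoff (fun _ => c)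
      (fun _ => c) e ≤ c :=
  Q.expectation_le s (fun _ => c) (fun _ => c) (fun _ _ => c) (fun _ _ _ _ => rfl)
    (fun _ _ => c) (fun _ _ _ _ _ => rfl) (fun _ _ _ _ => le_rfl)
    (fun _ => le_of_eq (by ring))
    (fun Ψ => le_of_eq (by rw [← Finset.mul_sum, ← Finset.mul_sum, sum_ampNormSq_test, ampNormSq]))
    (fun _ _ _ _ _ => le_rfl)

/-- Duality with constant observables bounds the expectation of the constant payoffs `1` and `-1`,
so the total probability is at most and at least one. -/
theorem hasSum_endProb (s : BuyerStrategy) : HasSum (endProb Q.seller s) 1 := by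
  have h := Q.hasSum_endProb_mul_sellerHistory s fun _ => 1
  have h1 := Q.sum_endProb_const s 1
  have h2 := Q.sum_endProb_const s (-1)
  simp only [historyPayoff_self, mul_neg, Finset.sum_neg_distrib, neg_le_neg_iff] at h h1 h2
  rw [le_antisymm h1 h2] at h
  simpa using h

/-- A bound `c` on all pure states extends to all strategies. The hypothesis on `fine` makes
quitting after the cut unprofitable: the continuation value there is never below `-(U / prob)`,
whereas quitting yields at most `U` minus the fine. -/
theorem expectedUtility_le (s : BuyerStrategy) (v : BundleValuation n) {U : ℝ}
    (hv : ∀ S, 0 ≤ v S ∧ v S ≤ U) (hfine : U + U / Q.prob ≤ Q.fine) {c : ℝ} (hc : 0 ≤ c)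
    (hmax : ∀ Ψ, Q.stateUtility v Ψ ≤ c * ampNormSq Ψ) :
    expectedUtility Q.seller s v ≤ c := by
  have hε := Q.prob_pos
  have hε1 : 0 ≤ 1 - Q.prob := sub_nonneg.mpr Q.prob_le
  have hcut := Q.cut_lt
  have hU : 0 ≤ U := (hv ∅).1.trans (hv ∅).2
  rw [expectedUtility, (Q.hasSum_endProb_mul_sellerHistory s
    fun h => v (Q.seller.alloc h) - Q.seller.pay h).tsum_eq]
  refine le_trans (Q.expectation_le s _ _
    (fun t r => if Q.len ≤ t then v Q.fallback - Q.price r else v (Q.bundle r)) ?_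
    -- Past the cut the weight is the value that makes the condition at the cut an equality. It
    -- depends only on the first `cut` places, so storing later qubits does not affect it.
    (fun t z => if t ≤ Q.cut then c else (c - (1 - Q.prob) * v (Q.bundle z)) / Q.prob)
    ?_ ?_ ?_ ?_ ?_) (le_of_eq (if_pos (Nat.zero_le _)))
  · intro x h r hr
    simp only [hr]
    split_ifs <;> simp
  · intro t i z q ht
    split_ifs with h
    · rfl
    · rw [Q.bundle_congr (Function.update z i q) z]
      intro j hj
      exact Function.update_of_ne (by rintro rfl; omega) _ _
  · intro t z _ htc
    have : t + 1 ≤ Q.cut ↔ t ≤ Q.cut := by omega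
    simp only [this]
    exact le_rfl
  · intro z
    rw [if_neg (by omega), if_neg (by omega), if_pos le_rfl, mul_div_cancel₀ _ hε.ne']
    linarith
  · intro Ψ
    simp only [le_refl, if_true, not_le.mpr hcut, if_false]
    have h := hmax Ψ
    rw [stateUtility] at h
    have h1 : ∑ z, (c - (1 - Q.prob) * v (Q.bundle z)) / Q.prob * Complex.normSq (Ψ z) =
        (c * ampNormSq Ψ - (1 - Q.prob) * ∑ z, v (Q.bundle z) * Complex.normSq (Ψ z)) /
          Q.prob := by
      rw [ampNormSq, Finset.mul_sum, Finset.mul_sum, ← Finset.sum_sub_distrib, Finset.sum_div]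
      exact Finset.sum_congr rfl fun z _ => by ring
    rw [h1, le_div_iff₀ hε]
    linarith
  · intro x h z hx _
    simp only [hx]
    have h1 := (hv Q.fallback).2
    have h2 : 0 ≤ U / Q.prob := by positivity
    split_ifs
    · linarith
    · have h3 : -(U / Q.prob) ≤ (c - (1 - Q.prob) * v (Q.bundle z)) / Q.prob := by
        rw [← neg_div]
        gcongr
        have h4 := mul_le_mul_of_nonneg_left (hv (Q.bundle z)).2 hε1
        nlinarith
      linarith

/-- Reaching the cut costs `2 * cut` qubits; only the event of probability `prob` that the seller
goes on pays for the full register. The extra `1` covers a buyer who quits after receiving one more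
qubit. -/
theorem expectedQubits_le (s : BuyerStrategy) : expectedQubits Q.seller s ≤
    ENNReal.ofReal (2 * Q.cut + Q.prob * (2 * Q.len + 1)) := by
  have hε := Q.prob_pos
  have hε1 : 0 ≤ 1 - Q.prob := sub_nonneg.mpr Q.prob_le
  have hcut := Q.cut_lt
  have hcut' : (Q.cut : ℝ) + 1 ≤ Q.len := by exact_mod_cast hcut
  set f : List ℕ → ℝ := fun h => 2 * (h.length - 1 : ℕ)
  set g : List ℕ → ℝ := fun h => 2 * (h.length - 1 : ℕ) + 1
  have hq : ∀ e : Ending, (e.qubits : ℝ) = historyPayoff f g e := by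
    rintro ⟨h, x, _ | y⟩ <;> simp [Ending.qubits, historyPayoff, f, g]
  have h1 : expectedQubits Q.seller s = ENNReal.ofReal (∑ e ∈ endings Q.seller s Q.len,
      endProb Q.seller s e * historyPayoff f g e) := by
    rw [expectedQubits, tsum_eq_sum (s := endings Q.seller s Q.len)]
    · rw [ENNReal.ofReal_sum_of_nonneg]
      · refine Finset.sum_congr rfl fun e _ => ?_
        rw [← hq, ENNReal.ofReal_mul (endProb_nonneg _ _ e), ENNReal.ofReal_natCast]
      · intro e _
        rw [← hq]
        exact mul_nonneg (endProb_nonneg _ _ e) (Nat.cast_nonneg _)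
    · intro e he
      rw [endProb_eq_zero_of_notMem_endings Q.seller s (Q.stateAfter_eq_zero s) he,
        ENNReal.ofReal_zero, zero_mul]
  rw [h1]
  refine ENNReal.ofReal_le_ofReal ?_
  refine le_trans (Q.expectation_le s f g (fun t _ => 2 * t) ?_
    (fun t _ => if t ≤ Q.cut then 2 * Q.cut + Q.prob * (2 * Q.len + 1) else 2 * Q.len + 1)
    ?_ ?_ ?_ ?_ ?_) (le_of_eq (if_pos (Nat.zero_le _)))
  · intro x h r _
    simp [f]
  · intro t i z q _
    rfl
  · intro t z _ htc
    have : t + 1 ≤ Q.cut ↔ t ≤ Q.cut := by omega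
    simp only [this]
    exact le_rfl
  · intro z
    rw [if_neg (by omega), if_pos le_rfl]
    nlinarith
  · intro Ψ
    simp only [not_le.mpr hcut, if_false]
    rw [← Finset.mul_sum, ← Finset.mul_sum, sum_ampNormSq_test, ← ampNormSq]
    exact mul_le_mul_of_nonneg_right (by linarith) (ampNormSq_nonneg Ψ)
  · intro x h z _ hl
    simp only [g, List.length_cons, Nat.add_sub_cancel]
    split_ifs with h2
    · have h3 : (h.length : ℝ) + 1 ≤ Q.cut := by exact_mod_cast h2
      have h4 : 0 ≤ Q.prob * (2 * (Q.len : ℝ) + 1) := by positivity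
      linarith
    · have h3 : (h.length : ℝ) ≤ Q.len := by exact_mod_cast hl
      linarith

end RegisterAuction

/-! ### Sending a register qubit by qubit -/

section Vectors

variable {a b : ℕ}

theorem onSeller_mulVec (A : Matrix (Reg a × Fin 2) (Reg a × Fin 2) ℂ) (ψ : Sys a b → ℂ)
    (f : Reg a) (q : Fin 2) (g : Reg b) :
    (onSeller b A *ᵥ ψ) (f, q, g) = (A *ᵥ fun p => ψ (p.1, p.2, g)) (f, q) := by
  simp only [Matrix.mulVec, dotProduct, onSeller, Fintype.sum_prod_type, Matrix.submatrix_apply,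
    Equiv.prodAssoc_symm_apply, Matrix.kroneckerMap_apply, Matrix.one_apply]
  simp

theorem onBuyer_mulVec (B : Matrix (Fin 2 × Reg b) (Fin 2 × Reg b) ℂ) (ψ : Sys a b → ℂ)
    (f : Reg a) (p : Fin 2 × Reg b) :
    (onBuyer a B *ᵥ ψ) (f, p) = (B *ᵥ fun p' => ψ (f, p')) p := by
  simp only [Matrix.mulVec, dotProduct, onBuyer, Matrix.kroneckerMap_apply, Matrix.one_apply]
  rw [Fintype.sum_prod_type, Finset.sum_eq_single f]
  · simp
  · intro f' _ hf
    exact Finset.sum_eq_zero fun p' _ => by simp [hf.symm]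
  · simp

/-- The (unnormalized) pure state with the given amplitudes. -/
def pureState {ι : Type} (ψ : ι → ℂ) : Matrix ι ι ℂ := Matrix.vecMulVec ψ (star ψ)

theorem applyOp_pureState {ι : Type} [Fintype ι] (A : Matrix ι ι ℂ) (ψ : ι → ℂ) :
    applyOp A (pureState ψ) = pureState (A *ᵥ ψ) := by
  rw [applyOp, pureState, pureState, Matrix.mul_vecMulVec, Matrix.vecMulVec_mul,
    Matrix.star_mulVec]

theorem trace_pureState {ι : Type} [Fintype ι] (ψ : ι → ℂ) :
    (pureState ψ).trace.re = ampNormSq ψ := by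
  rw [pureState, Matrix.trace_vecMulVec, dotProduct_comm, star_dotProduct_self, Complex.ofReal_re]

theorem pureState_zero {ι : Type} : pureState (0 : ι → ℂ) = 0 := by
  simp [pureState]

theorem ampNormSq_smul {ι : Type} [Fintype ι] (c : ℂ) (ψ : ι → ℂ) :
    ampNormSq (c • ψ) = Complex.normSq c * ampNormSq ψ := by
  simp [ampNormSq, Finset.mul_sum]

theorem initialState_eq_pureState (a b : ℕ) : initialState a b = pureState (Pi.single 0 1) := by
  rw [initialState, pureState, ← Pi.single_star, star_one, Matrix.single_eq_single_vecMulVec_single]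

theorem sum_mul_normSq_extend {ι κ : Type} [Fintype ι] [Fintype κ] {e : ι → κ}
    (he : Function.Injective e) (Ψ : ι → ℂ) (d : κ → ℝ) :
    ∑ l, d l * Complex.normSq (Function.extend e Ψ 0 l) =
      ∑ z, d (e z) * Complex.normSq (Ψ z) := by
  symm
  refine Fintype.sum_of_injective e he _ _ ?_ ?_
  · intro l hl
    rw [Function.extend_apply' _ _ _ (fun ⟨z, hz⟩ => hl ⟨z, hz⟩)]
    simp
  · intro z
    rw [he.extend_apply]

theorem extend_comp_apply {ι κ : Type} {e : ι → κ} (he : Function.Injective e) {π : κ → κ}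
    (hπ : Function.Injective π) (Ψ : ι → ℂ) (l : κ) :
    Function.extend (π ∘ e) Ψ 0 (π l) = Function.extend e Ψ 0 l := by
  by_cases h : ∃ z, e z = l
  · obtain ⟨z, rfl⟩ := h
    rw [he.extend_apply]
    exact (hπ.comp he).extend_apply Ψ 0 z
  · rw [Function.extend_apply' _ _ _ h, Function.extend_apply']
    · rfl
    · rintro ⟨z, hz⟩
      exact h ⟨z, hπ hz⟩

end Vectors

section Sender

variable {L : ℕ}

/-- Exchange of the travelling qubit with the buyer's private qubit `t`. -/
def sendPerm (L t : ℕ) : Equiv.Perm (Fin 2 × Reg L) :=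
  if h : t < L then
    Function.Involutive.toPerm (fun p => (p.2 ⟨t, h⟩, Function.update p.2 ⟨t, h⟩ p.1))
      fun p => by simp
  else 1

theorem sendPerm_apply {t : ℕ} (h : t < L) (p : Fin 2 × Reg L) :
    sendPerm L t p = (p.2 ⟨t, h⟩, Function.update p.2 ⟨t, h⟩ p.1) := by
  rw [sendPerm, dif_pos h]
  rfl

theorem receivePerm_apply {t : ℕ} (h : t < L) (p : Reg L × Fin 2) :
    receivePerm L (t + 1) p = (Function.update p.1 ⟨t, h⟩ p.2, p.1 ⟨t, h⟩) := by
  rw [receivePerm, dif_pos ⟨by omega, by omega⟩]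
  rfl

/-- The basis state of the whole system when the seller has stored the first `t` qubits of the
register state `z` and the buyer still holds the others. -/
def splitLabel (t : ℕ) (z : Reg L) : Sys L L :=
  (fun i => if i.val < t then z i else 0, 0, fun i => if i.val < t then 0 else z i)

theorem splitLabel_injective (t : ℕ) : Function.Injective (splitLabel (L := L) t) := by
  intro z z' h
  rw [splitLabel, splitLabel, Prod.mk.injEq, Prod.mk.injEq] at h
  ext i
  have h1 := congrFun h.1 i
  have h2 := congrFun h.2.2 i
  by_cases hi : i.val < t
  · simp only [hi, if_true] at h1
    rw [h1]
  · simp only [hi, if_false] at h2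
    rw [h2]

/-- The state of the whole system when the seller has stored `t` qubits of the register. -/
noncomputable def splitVec (Ψ : Reg L → ℂ) (t : ℕ) : Sys L L → ℂ :=
  Function.extend (splitLabel t) Ψ 0

/-- Permutation matrices act on amplitudes by composition, so sending and storing one qubit is the
single relabelling `π` of the basis, and `splitLabel t = π ∘ splitLabel (t + 1)`. -/
theorem receive_send_splitVec (Ψ : Reg L → ℂ) {t : ℕ} (ht : t < L) :
    onSeller L (receiveOp L (t + 1)) *ᵥ
      (onBuyer L ((sendPerm L t).permMatrix ℂ) *ᵥ splitVec Ψ t) = splitVec Ψ (t + 1) := by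
  set i : Fin L := ⟨t, ht⟩
  let π : Sys L L → Sys L L := fun l =>
    (Function.update l.1 i l.2.1, l.2.2 i, Function.update l.2.2 i (l.1 i))
  have hπ : Function.Injective π := by
    rintro ⟨f, q, g⟩ ⟨f', q', g'⟩ h
    simp only [π, Prod.mk.injEq] at h
    obtain ⟨h1, h2, h3⟩ := h
    have hq : q = q' := by simpa using congrFun h1 i
    have hf : f i = f' i := by simpa using congrFun h3 i
    have hf' : f = f' := by
      ext j
      by_cases hj : j = i
      · rw [hj, hf]
      · simpa [hj] using congrArg Fin.val (congrFun h1 j)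
    have hg' : g = g' := by
      ext j
      by_cases hj : j = i
      · rw [hj, h2]
      · simpa [hj] using congrArg Fin.val (congrFun h3 j)
    rw [hq, hf', hg']
  have hcomp : splitLabel t = π ∘ splitLabel (t + 1) := by
    ext1 z
    simp only [splitLabel, π, Function.comp_apply, Prod.mk.injEq]
    refine ⟨?_, ?_, ?_⟩
    · ext j
      by_cases hj : j = i
      · subst hj; simp [i]
      · have : j.val ≠ t := fun h => hj (Fin.ext h)
        rw [Function.update_of_ne hj]
        have : j.val < t + 1 ↔ j.val < t := by omega
        simp [this]
    · simp [i]
    · ext j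
      by_cases hj : j = i
      · subst hj; simp [i]
      · have : j.val ≠ t := fun h => hj (Fin.ext h)
        rw [Function.update_of_ne hj]
        have : j.val < t + 1 ↔ j.val < t := by omega
        simp [this]
  ext ⟨f, q, g⟩
  rw [onSeller_mulVec, receiveOp, Matrix.permMatrix_mulVec, Function.comp_apply,
    receivePerm_apply ht, onBuyer_mulVec, Matrix.permMatrix_mulVec, Function.comp_apply,
    sendPerm_apply ht, splitVec, splitVec, hcomp]
  exact extend_comp_apply (splitLabel_injective (t + 1)) hπ Ψ (f, q, g)

/-- The operator with which the buyer prepares the state `Ψ` of his register. -/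
noncomputable def prepareOp (Ψ : Reg L → ℂ) : Matrix (Fin 2 × Reg L) (Fin 2 × Reg L) ℂ :=
  Matrix.vecMulVec (fun p => if p.1 = 0 then Ψ p.2 else 0) (Pi.single 0 1)

theorem prepareOp_conj (Ψ : Reg L → ℂ) (hΨ : ampNormSq Ψ = 1) :
    (prepareOp Ψ)ᴴ * prepareOp Ψ = Matrix.single 0 0 1 := by
  have h : star (fun p : Fin 2 × Reg L => if p.1 = 0 then Ψ p.2 else 0) ⬝ᵥ
      (fun p : Fin 2 × Reg L => if p.1 = 0 then Ψ p.2 else 0) = 1 := by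
    rw [star_dotProduct_self, ampNormSq, Fintype.sum_prod_type]
    rw [ampNormSq] at hΨ
    simp [hΨ]
  rw [prepareOp, Matrix.conjTranspose_vecMulVec, Matrix.vecMulVec_mul_vecMulVec, h, one_smul,
    ← Pi.single_star, star_one, Matrix.single_eq_single_vecMulVec_single]

/-- The operators of the buyer's measurement in his turn after `t` rounds. The second outcome never
occurs. -/
noncomputable def senderOp (Ψ : Reg L → ℂ) (t : ℕ) :
    Fin 2 → Matrix (Fin 2 × Reg L) (Fin 2 × Reg L) ℂ :=
  if t = 0 then ![(sendPerm L 0).permMatrix ℂ * prepareOp Ψ, 1 - Matrix.single 0 0 1]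
  else ![(sendPerm L t).permMatrix ℂ, 0]

theorem sum_senderOp (Ψ : Reg L → ℂ) (hΨ : ampNormSq Ψ = 1) (t : ℕ) :
    ∑ y, (senderOp Ψ t y)ᴴ * senderOp Ψ t y = 1 := by
  rw [Fin.sum_univ_two, senderOp]
  split_ifs
  · simp only [Matrix.cons_val_zero, Matrix.cons_val_one]
    rw [Matrix.conjTranspose_mul, Matrix.mul_assoc, ← Matrix.mul_assoc _ _ (prepareOp Ψ),
      permMatrix_conjTranspose_mul_self, Matrix.one_mul, prepareOp_conj Ψ hΨ]
    simp [Matrix.sub_mul, Matrix.mul_sub]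
  · simp only [Matrix.cons_val_zero, Matrix.cons_val_one]
    rw [permMatrix_conjTranspose_mul_self]
    simp

/-- The buyer's strategy that prepares the state `Ψ` of a register and sends it qubit by qubit. -/
noncomputable abbrev sender (Ψ : Reg L → ℂ) (hΨ : ampNormSq Ψ = 1) : BuyerStrategy where
  mem := L
  meas h := ⟨2, senderOp Ψ h.length, sum_senderOp Ψ hΨ h.length⟩
  quit _ := false

/-- The state of the whole system, up to normalization, at the start of the seller's turn after `t`
rounds. -/
noncomputable def senderVec (Ψ : Reg L → ℂ) : ℕ → Sys L L → ℂ
  | 0 => Pi.single 0 1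
  | t + 1 => onBuyer L ((sendPerm L t).permMatrix ℂ) *ᵥ splitVec Ψ t

theorem prepareOp_initial (Ψ : Reg L → ℂ) :
    onBuyer L (prepareOp Ψ) *ᵥ (Pi.single 0 1 : Sys L L → ℂ) = splitVec Ψ 0 := by
  ext ⟨f, q, g⟩
  rw [onBuyer_mulVec]
  have h1 : (prepareOp Ψ *ᵥ fun p' => (Pi.single 0 1 : Sys L L → ℂ) (f, p')) (q, g) =
      if f = 0 ∧ q = 0 then Ψ g else 0 := by
    rw [prepareOp, Matrix.vecMulVec_mulVec]
    by_cases hf : f = 0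
    · by_cases hq : q = 0
      · have h0 : (fun p' => (Pi.single 0 1 : Sys L L → ℂ) (f, p')) = Pi.single 0 1 := by
          ext p'
          simp [hf, Pi.single_apply, Prod.ext_iff]
        rw [h0]
        simp [hf, hq]
      · simp [hq]
    · simp [hf, Pi.single_apply, dotProduct, Prod.ext_iff]
  rw [h1, splitVec]
  split_ifs with h
  · have h2 : ((f, q, g) : Sys L L) = splitLabel 0 g := by
      rw [h.1, h.2]
      simp only [splitLabel, Nat.not_lt_zero, if_false]
      rfl
    rw [h2, (splitLabel_injective 0).extend_apply]
  · rw [Function.extend_apply']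
    · rfl
    · rintro ⟨z, hz⟩
      apply h
      simp only [splitLabel, Nat.not_lt_zero, if_false, Prod.mk.injEq] at hz
      exact ⟨hz.1.symm, hz.2.1.symm⟩

end Sender

/-! ### The run against the buyer who sends a prepared state -/

namespace RegisterAuction

variable {n : ℕ} (Q : RegisterAuction n)

/-- The number that encodes the seller's decision to go on. -/
noncomputable def proceed : ℕ := (Fintype.equivFin (Option (Reg Q.len)) none).val

theorem proceed_lt : Q.proceed < Fintype.card (Option (Reg Q.len)) :=
  (Fintype.equivFin (Option (Reg Q.len)) none).isLt

theorem decode_proceed : decodeOutcome (Reg Q.len) Q.proceed = none := by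
  rw [decodeOutcome, dif_pos Q.proceed_lt]
  exact (Fintype.equivFin (Option (Reg Q.len))).symm_apply_apply none

theorem eq_proceed {x : ℕ} (hx : x < Fintype.card (Option (Reg Q.len)))
    (h : decodeOutcome (Reg Q.len) x = none) : x = Q.proceed := by
  rw [decodeOutcome, dif_pos hx, Equiv.symm_apply_eq] at h
  exact congrArg Fin.val h

/-- The amplitude of the event that the protocol reaches the seller's turn after `t` rounds. -/
noncomputable def weight (t : ℕ) : ℝ := if t ≤ Q.cut then 1 else Real.sqrt Q.prob

theorem memoryOp_none {t : ℕ} (ht : t < Q.len) :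
    (Q.weight t : ℂ) • Q.memoryOp t none = (Q.weight (t + 1) : ℂ) • 1 := by
  rw [memoryOp, if_neg (not_le.mpr ht), weight, weight]
  by_cases h1 : t = Q.cut
  · simp [h1]
  · have : t + 1 ≤ Q.cut ↔ t ≤ Q.cut := by omega
    simp [h1, this]

variable (Ψ : Reg Q.len → ℂ) (hΨ : ampNormSq Ψ = 1)

/-- The state of the whole system after the seller has stored the travelling qubit. -/
noncomputable def receivedVec (t : ℕ) : Sys Q.len Q.len → ℂ :=
  onSeller Q.len (receiveOp Q.len t) *ᵥ senderVec Ψ t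

theorem receivedVec_succ {t : ℕ} (ht : t < Q.len) :
    Q.receivedVec Ψ (t + 1) = splitVec Ψ (t + 1) :=
  receive_send_splitVec Ψ ht

theorem receivedVec_zero : Q.receivedVec Ψ 0 = Pi.single 0 1 := by
  have h : receiveOp Q.len 0 = 1 := by
    simp [receiveOp, receivePerm]
  rw [receivedVec, h, onSeller_one, Matrix.one_mulVec, senderVec]

theorem onSeller_turnOp_mulVec (t : ℕ) (o : Option (Reg Q.len)) (w : ℂ) :
    onSeller Q.len (Q.turnOp t o) *ᵥ (w • senderVec Ψ t) =
      onSeller Q.len (onMemory (w • Q.memoryOp t o)) *ᵥ Q.receivedVec Ψ t := by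
  rw [turnOp, onSeller_mul, ← Matrix.mulVec_mulVec, Matrix.mulVec_smul, Matrix.mulVec_smul,
    ← Matrix.smul_mulVec, ← onSeller_smul, ← onMemory_smul, receivedVec]

theorem senderOp_receivedVec {t : ℕ} (ht : t ≤ Q.len) :
    onBuyer Q.len (senderOp Ψ t 0) *ᵥ Q.receivedVec Ψ t = senderVec Ψ (t + 1) := by
  cases t with
  | zero =>
    rw [receivedVec_zero, senderVec, ← prepareOp_initial, senderOp, if_pos rfl]
    rw [Matrix.mulVec_mulVec, Matrix.cons_val_zero, onBuyer, onBuyer, onBuyer,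
      ← Matrix.mul_kronecker_mul, Matrix.one_mul]
  | succ t =>
    rw [receivedVec_succ Q Ψ ht, senderVec, senderOp, if_neg (Nat.succ_ne_zero t),
      Matrix.cons_val_zero]

theorem sender_kraus (h : List ℕ) (y : Fin 2) :
    ((sender Ψ hΨ).meas h).kraus y = senderOp Ψ h.length y := by
  rw [Measurement.kraus]
  exact dif_pos y.isLt

/-- The history in which the seller always proceeds and the buyer always sees outcome `0` is the
only one that survives; `weight` records the factor `√prob` acquired at the cut. -/
theorem stateAfter_sender {t : ℕ} (ht : t ≤ Q.len) :
    stateAfter Q.seller (sender Ψ hΨ) (List.replicate t (Q.proceed, 0)) =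
      pureState ((Q.weight t : ℂ) • senderVec Ψ t) := by
  induction t with
  | zero =>
    rw [List.replicate_zero, stateAfter, initialState_eq_pureState]
    simp [weight, senderVec]
  | succ t ih =>
    rw [List.replicate_succ, stateAfter, if_neg (by simp [Q.decode_proceed]), ih (by omega)]
    rw [sellerStep, Q.seller_kraus _ Q.proceed_lt, Q.decode_proceed, applyOp_pureState,
      List.length_map, List.length_replicate, onSeller_turnOp_mulVec, Q.memoryOp_none (by omega),
      onMemory_smul, onMemory_one, onSeller_smul, onSeller_one, Matrix.smul_mulVec,
      Matrix.one_mulVec, buyerStep]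
    have hk := sender_kraus Q Ψ hΨ (List.map Prod.snd (List.replicate t (Q.proceed, 0))) 0
    rw [Fin.val_zero] at hk
    rw [hk, applyOp_pureState, List.length_map, List.length_replicate, Matrix.mulVec_smul,
      senderOp_receivedVec Q Ψ (by omega)]

/-- A history leaves the surviving one through a halting outcome, a label out of range, or the
buyer's outcome `1`. The latter has operator `0` after his first turn, and on his first turn it
projects onto the complement of the initial state of his qubits. -/
theorem stateAfter_sender_eq_zero (h : List (ℕ × ℕ))
    (hne : h ≠ List.replicate h.length (Q.proceed, 0)) :
    stateAfter Q.seller (sender Ψ hΨ) h = 0 := by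
  induction h with
  | nil => simp at hne
  | cons p h ih =>
    obtain ⟨x, y⟩ := p
    rw [stateAfter]
    split_ifs with hq
    · rfl
    by_cases hh : h = List.replicate h.length (Q.proceed, 0)
    · by_cases hx : x = Q.proceed
      · have hy : y ≠ 0 := by
          rintro rfl
          apply hne
          rw [List.length_cons, List.replicate_succ, ← hh, hx]
        by_cases hy2 : 2 ≤ y
        · exact buyerStep_of_le _ _ hy2 _
        · have hy1 : y = 1 := by omega
          by_cases hl : Q.len < h.length
          · rw [Q.stateAfter_eq_zero _ _ hl, sellerStep_zero, buyerStep_zero]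
          have hk := sender_kraus Q Ψ hΨ (List.map Prod.snd h) 1
          rw [Fin.val_one] at hk
          rw [hy1, buyerStep, hk, List.length_map]
          cases hc : h.length with
          | zero =>
            rw [List.length_eq_zero_iff] at hc
            rw [hc, hx, sellerStep, Q.seller_kraus _ Q.proceed_lt, Q.decode_proceed, stateAfter,
              initialState_eq_pureState, applyOp_pureState, applyOp_pureState, List.map_nil,
              List.length_nil]
            have h1 := Q.onSeller_turnOp_mulVec Ψ 0 none (Q.weight 0 : ℂ)
            rw [Q.memoryOp_none (by have := Q.cut_lt; omega), receivedVec_zero, onMemory_smul,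
              onMemory_one, onSeller_smul, onSeller_one, Matrix.smul_mulVec, Matrix.one_mulVec]
              at h1
            have hc1 := Q.cut_pos
            simp only [weight, Nat.zero_le, if_true, Nat.zero_add, hc1, Complex.ofReal_one,
              one_smul, senderVec] at h1
            have h2 : onBuyer Q.len (senderOp Ψ 0 1) *ᵥ (Pi.single 0 1 : Sys Q.len Q.len → ℂ)
                = 0 := by
              ext ⟨f, p⟩
              rw [onBuyer_mulVec]
              by_cases hf : f = 0
              · have h0 : (fun p' => (Pi.single 0 1 : Sys Q.len Q.len → ℂ) (f, p')) =
                    Pi.single 0 1 := by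
                  ext p'
                  simp [hf, Pi.single_apply, Prod.ext_iff]
                rw [h0]
                rw [senderOp, if_pos rfl, Matrix.cons_val_one, Matrix.cons_val_zero,
                  Matrix.sub_mulVec, Matrix.one_mulVec]
                simp [Matrix.single_apply, Pi.single_apply, eq_comm]
              · have h0 : (fun p' => (Pi.single 0 1 : Sys Q.len Q.len → ℂ) (f, p')) = 0 := by
                  ext p'
                  simp [hf, Prod.ext_iff]
                rw [h0]
                simp
            rw [h1, h2, pureState_zero]
          | succ t =>
            simp [senderOp, onBuyer, applyOp]
      · by_cases hxl : x < Fintype.card (Option (Reg Q.len))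
        · have hd : decodeOutcome (Reg Q.len) x ≠ none := fun hd => hx (Q.eq_proceed hxl hd)
          exact absurd (by simp [Option.isSome_iff_ne_none.mpr hd]) hq
        · rw [sellerStep_of_le _ _ (not_lt.mp hxl), buyerStep_zero]
    · rw [ih hh, sellerStep_zero, buyerStep_zero]

theorem roundValue_of_stateAfter_eq_zero (s : BuyerStrategy) (φ : Ending → ℝ)
    {h : List (ℕ × ℕ)} (hs : stateAfter Q.seller s h = 0) : roundValue Q.seller s φ h = 0 := by
  simp [roundValue, endProb, hs, sellerStep_zero, buyerStep_zero]

theorem roundValue_sender (f : List ℕ → ℝ) (F : ℕ → Reg Q.len → ℝ)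
    (hf : ∀ x h r, decodeOutcome (Reg Q.len) x = some r → f (x :: h) = F h.length r)
    {t : ℕ} (ht : t ≤ Q.len) :
    roundValue Q.seller (sender Ψ hΨ) (historyPayoff f f) (List.replicate t (Q.proceed, 0)) =
      ∑ r, F t r * ampNormSq (onSeller Q.len (onMemory ((Q.weight t : ℂ) •
        Q.memoryOp t (some r))) *ᵥ Q.receivedVec Ψ t) := by
  have h1 : ∑ r, F t r * ampNormSq (onSeller Q.len (onMemory ((Q.weight t : ℂ) •
        Q.memoryOp t (some r))) *ᵥ Q.receivedVec Ψ t) = ∑ o : Option (Reg Q.len), match o with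
      | none => 0
      | some r => F t r * ampNormSq (onSeller Q.len (onMemory ((Q.weight t : ℂ) •
          Q.memoryOp t (some r))) *ᵥ Q.receivedVec Ψ t) := by
    rw [Fintype.sum_option, zero_add]
  rw [h1, ← sum_range_decodeOutcome, roundValue]
  refine Finset.sum_congr rfl fun x hx => ?_
  have h2 : ∀ y, endProb Q.seller (sender Ψ hΨ)
      (List.replicate t (Q.proceed, 0), x, some y) = 0 := fun y => by simp [endProb]
  simp only [h2, zero_mul, Finset.sum_const_zero, add_zero]
  rw [endProb]
  cases hd : decodeOutcome (Reg Q.len) x with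
  | none => simp [hd]
  | some r =>
    rw [if_pos (by simp [hd]), stateAfter_sender Q Ψ hΨ ht, sellerStep,
      Q.seller_kraus _ (Finset.mem_range.mp hx), hd, applyOp_pureState, trace_pureState,
      historyPayoff, hf x _ r hd, List.length_map, List.length_replicate, onSeller_turnOp_mulVec,
      mul_comm]

/-- At the cut the later places of the seller's memory still hold `|0⟩`, so she reads the truncation
of `z`. This is why bundles may depend only on the first `cut` qubits. -/
theorem ampNormSq_cut (r : Reg Q.len) :
    ampNormSq (onSeller Q.len (onMemory ((Q.weight Q.cut : ℂ) • Q.memoryOp Q.cut (some r))) *ᵥ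
      Q.receivedVec Ψ Q.cut) = (1 - Q.prob) *
        ∑ z, (if (splitLabel Q.cut z).1 = r then 1 else 0) * Complex.normSq (Ψ z) := by
  have hc := Q.cut_lt
  have hp := Q.cut_pos
  obtain ⟨c, hcc⟩ : ∃ c, Q.cut = c + 1 := ⟨Q.cut - 1, by omega⟩
  have hrec : Q.receivedVec Ψ Q.cut = splitVec Ψ Q.cut := by
    rw [hcc]
    exact receivedVec_succ Q Ψ (by omega)
  rw [hrec, ← sum_mul_normSq_extend (splitLabel_injective Q.cut) Ψ
    fun l => if l.1 = r then 1 else 0, memoryOp, if_neg (not_le.mpr hc), if_pos rfl, weight,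
    if_pos le_rfl, Complex.ofReal_one, one_smul, onMemory_smul, onSeller_smul, Matrix.smul_mulVec,
    ampNormSq_smul, Complex.normSq_ofReal, Real.mul_self_sqrt (sub_nonneg.mpr Q.prob_le)]
  congr 1
  refine Finset.sum_congr rfl fun l _ => ?_
  obtain ⟨f, q, g⟩ := l
  rw [onSeller_mulVec, onMemory, ← Matrix.diagonal_single, ← Matrix.diagonal_one,
    Matrix.diagonal_kronecker_diagonal, Matrix.mulVec_diagonal, splitVec, Pi.single_apply]
  split_ifs <;> simp

theorem ampNormSq_last (r : Reg Q.len) :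
    ampNormSq (onSeller Q.len (onMemory ((Q.weight Q.len : ℂ) • Q.memoryOp Q.len (some r))) *ᵥ
      Q.receivedVec Ψ Q.len) = Q.prob * ampNormSq (Q.test r *ᵥ Ψ) := by
  have hc := Q.cut_lt
  have hp := Q.cut_pos
  have hrec : Q.receivedVec Ψ Q.len = splitVec Ψ Q.len := by
    obtain ⟨c, hcc⟩ : ∃ c, Q.len = c + 1 := ⟨Q.len - 1, by omega⟩
    have : ∀ m, m = c + 1 → Q.receivedVec Ψ m = splitVec Ψ m := by
      rintro m rfl
      exact receivedVec_succ Q Ψ (by omega)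
    exact this _ hcc
  rw [hrec, memoryOp, if_pos le_rfl, weight, if_neg (not_le.mpr hc), onMemory_smul, onSeller_smul,
    Matrix.smul_mulVec, ampNormSq_smul, Complex.normSq_ofReal, Real.mul_self_sqrt Q.prob_pos.le]
  congr 1
  have hvec : ∀ (f : Reg Q.len) (q : Fin 2) (g : Reg Q.len), splitVec Ψ Q.len (f, q, g) =
      if q = 0 ∧ g = 0 then Ψ f else 0 := by
    intro f q g
    rw [splitVec]
    have hl : ∀ z : Reg Q.len, splitLabel Q.len z = (z, 0, 0) := by
      intro z
      simp only [splitLabel, Fin.is_lt, if_true]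
      rfl
    split_ifs with h
    · rw [h.1, h.2, ← hl, (splitLabel_injective _).extend_apply]
    · rw [Function.extend_apply']
      · rfl
      · rintro ⟨z, hz⟩
        rw [hl, Prod.mk.injEq, Prod.mk.injEq] at hz
        exact h ⟨hz.2.1.symm, hz.2.2.symm⟩
  have hentry : ∀ (f : Reg Q.len) (q : Fin 2) (g : Reg Q.len),
      (onSeller Q.len (onMemory (Q.test r)) *ᵥ splitVec Ψ Q.len) (f, q, g) =
        if q = 0 ∧ g = 0 then (Q.test r *ᵥ Ψ) f else 0 := by
    intro f q g
    rw [onSeller_mulVec]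
    simp only [hvec, Matrix.mulVec, dotProduct, onMemory, Matrix.kroneckerMap_apply,
      Fintype.sum_prod_type, Matrix.one_apply]
    by_cases h : q = 0 <;> by_cases h' : g = 0 <;> simp [h, h']
  rw [ampNormSq, ampNormSq, Fintype.sum_prod_type]
  refine Finset.sum_congr rfl fun f _ => ?_
  rw [Fintype.sum_prod_type, Finset.sum_eq_single 0, Finset.sum_eq_single 0]
  · simp [hentry]
  · intro g _ hg
    simp [hentry, hg]
  · simp
  · intro q _ hq
    exact Finset.sum_eq_zero fun g _ => by simp [hentry, hq]
  · simp

/-- Before the last turn, the operators of the halting outcomes vanish except at the cut. So only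
two turns contribute, one for each branch of the protocol. -/
theorem sender_expectation (f : List ℕ → ℝ) (F : ℕ → Reg Q.len → ℝ)
    (hf : ∀ x h r, decodeOutcome (Reg Q.len) x = some r → f (x :: h) = F h.length r) :
    ∑' e : Ending, endProb Q.seller (sender Ψ hΨ) e * f e.sellerHistory =
      (1 - Q.prob) * ∑ z, F Q.cut (splitLabel Q.cut z).1 * Complex.normSq (Ψ z) +
        Q.prob * ∑ r, F Q.len r * ampNormSq (Q.test r *ᵥ Ψ) := by
  have hc := Q.cut_lt
  rw [(Q.hasSum_endProb_mul_sellerHistory (sender Ψ hΨ) f).tsum_eq, sum_endings]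
  have hsum : ∀ t, ∑ h ∈ histories Q.seller (sender Ψ hΨ) t,
      roundValue Q.seller (sender Ψ hΨ) (historyPayoff f f) h =
      roundValue Q.seller (sender Ψ hΨ) (historyPayoff f f)
        (List.replicate t (Q.proceed, 0)) := by
    intro t
    refine Finset.sum_eq_single _ ?_ ?_
    · intro h hh hne
      refine Q.roundValue_of_stateAfter_eq_zero _ _ (stateAfter_sender_eq_zero Q Ψ hΨ h ?_)
      rwa [length_of_mem_histories _ _ hh]
    · intro hh
      refine Q.roundValue_of_stateAfter_eq_zero _ _ ?_
      by_contra hs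
      apply hh
      have := mem_histories_of_stateAfter_ne_zero _ _ hs
      rwa [List.length_replicate] at this
  simp only [hsum]
  rw [Finset.sum_range_succ, Finset.sum_eq_single Q.cut]
  · rw [roundValue_sender Q Ψ hΨ f F hf hc.le, roundValue_sender Q Ψ hΨ f F hf le_rfl]
    congr 1
    · simp only [ampNormSq_cut, Finset.mul_sum]
      rw [Finset.sum_comm]
      refine Finset.sum_congr rfl fun z _ => ?_
      rw [Finset.sum_eq_single (splitLabel Q.cut z).1]
      · rw [if_pos rfl]
        ring
      · intro r _ hr
        rw [if_neg hr.symm]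
        ring
      · simp
    · simp only [ampNormSq_last, Finset.mul_sum]
      exact Finset.sum_congr rfl fun r _ => by ring
  · intro t ht htc
    rw [Finset.mem_range] at ht
    rw [roundValue_sender Q Ψ hΨ f F hf ht.le]
    refine Finset.sum_eq_zero fun r _ => ?_
    rw [memoryOp, if_neg (not_le.mpr ht), if_neg htc, smul_zero]
    simp [onMemory, onSeller, ampNormSq]
  · intro h
    exact absurd (Finset.mem_range.mpr hc) h

theorem expectedUtility_sender (v : BundleValuation n) :
    expectedUtility Q.seller (sender Ψ hΨ) v = Q.stateUtility v Ψ := by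
  have hc := Q.cut_lt
  rw [expectedUtility, sender_expectation Q Ψ hΨ (fun h => v (Q.seller.alloc h) - Q.seller.pay h)
    (fun t r => if Q.len ≤ t then v Q.fallback - Q.price r else v (Q.bundle r)), stateUtility]
  · simp only [not_le.mpr hc, if_false, le_refl, if_true]
    have hb : ∀ z, Q.bundle (splitLabel Q.cut z).1 = Q.bundle z := fun z =>
      Q.bundle_congr _ _ fun i hi => by simp [splitLabel, hi]
    simp only [hb]
  · intro x h r hr
    simp only [hr]
    split_ifs <;> simp

theorem expectedPayment_sender :
    expectedPayment Q.seller (sender Ψ hΨ) = Q.statePayment Ψ := by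
  have hc := Q.cut_lt
  rw [expectedPayment, sender_expectation Q Ψ hΨ Q.seller.pay
    (fun t r => if Q.len ≤ t then Q.price r else 0), statePayment]
  · simp [not_le.mpr hc]
  · intro x h r hr
    simp only [hr]

end RegisterAuction

/-! ### Best responses -/

theorem isCompact_unitVectors (ι : Type) [Fintype ι] :
    IsCompact {Ψ : ι → ℂ | ampNormSq Ψ = 1} := by
  refine Metric.isCompact_of_isClosed_isBounded ?_ ?_
  · refine isClosed_eq ?_ continuous_const
    unfold ampNormSq
    exact continuous_finsetSum _ fun z _ => Complex.continuous_normSq.comp (continuous_apply z)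
  · refine (Metric.isBounded_closedBall (x := (0 : ι → ℂ)) (r := 1)).subset ?_
    intro Ψ hΨ
    rw [mem_closedBall_zero_iff, pi_norm_le_iff_of_nonneg zero_le_one]
    intro z
    have h : Complex.normSq (Ψ z) ≤ 1 := by
      have h1 : ampNormSq Ψ = 1 := hΨ
      rw [← h1, ampNormSq]
      exact Finset.single_le_sum (f := fun z => Complex.normSq (Ψ z))
        (fun _ _ => Complex.normSq_nonneg _) (Finset.mem_univ z)
    rw [Complex.normSq_eq_norm_sq] at h
    exact (sq_le_one_iff₀ (norm_nonneg _)).mp h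

theorem continuous_ampNormSq_mulVec {ι : Type} [Fintype ι] (A : Matrix ι ι ℂ) :
    Continuous fun Ψ : ι → ℂ => ampNormSq (A *ᵥ Ψ) := by
  unfold ampNormSq
  refine continuous_finsetSum _ fun z _ => Complex.continuous_normSq.comp ?_
  exact (continuous_apply z).comp (continuous_const.matrix_mulVec continuous_id)

namespace RegisterAuction

variable {n : ℕ} (Q : RegisterAuction n)

theorem continuous_stateUtility :
    Continuous fun p : BundleValuation n × (Reg Q.len → ℂ) => Q.stateUtility p.1 p.2 := by
  unfold stateUtility
  refine Continuous.add (continuous_const.mul (continuous_finsetSum _ fun z _ => ?_))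
    (continuous_const.mul (continuous_finsetSum _ fun r _ => ?_))
  · exact ((continuous_apply _).comp continuous_fst).mul
      (Complex.continuous_normSq.comp ((continuous_apply z).comp continuous_snd))
  · exact (((continuous_apply _).comp continuous_fst).sub continuous_const).mul
      ((continuous_ampNormSq_mulVec _).comp continuous_snd)

theorem continuous_statePayment : Continuous Q.statePayment :=
  continuous_const.mul (continuous_finsetSum _ fun _ _ =>
    continuous_const.mul (continuous_ampNormSq_mulVec _))

theorem stateUtility_smul (v : BundleValuation n) (c : ℂ) (Ψ : Reg Q.len → ℂ) :
    Q.stateUtility v (c • Ψ) = Complex.normSq c * Q.stateUtility v Ψ := by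
  simp only [stateUtility, Matrix.mulVec_smul, ampNormSq_smul, Pi.smul_apply, smul_eq_mul,
    Complex.normSq_mul]
  have h1 : ∀ f : Reg Q.len → ℝ, ∑ z, f z * (Complex.normSq c * Complex.normSq (Ψ z)) =
      Complex.normSq c * ∑ z, f z * Complex.normSq (Ψ z) := fun f => by
    rw [Finset.mul_sum]
    exact Finset.sum_congr rfl fun z _ => by ring
  have h2 : ∀ f : Reg Q.len → ℝ, ∑ r, f r * (Complex.normSq c * ampNormSq (Q.test r *ᵥ Ψ)) =
      Complex.normSq c * ∑ r, f r * ampNormSq (Q.test r *ᵥ Ψ) := fun f => by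
    rw [Finset.mul_sum]
    exact Finset.sum_congr rfl fun z _ => by ring
  rw [h1, h2]
  ring

/-- Both sides are homogeneous of degree two. The form for arbitrary vectors is what the positivity
condition of the duality needs. -/
theorem stateUtility_le_mul (v : BundleValuation n) {c : ℝ}
    (hmax : ∀ Φ, ampNormSq Φ = 1 → Q.stateUtility v Φ ≤ c) (Ψ : Reg Q.len → ℂ) :
    Q.stateUtility v Ψ ≤ c * ampNormSq Ψ := by
  rcases (ampNormSq_nonneg Ψ).eq_or_lt with h0 | hpos
  · have hz : Ψ = 0 := by
      ext z
      have := (Finset.sum_eq_zero_iff_of_nonneg (f := fun z => Complex.normSq (Ψ z))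
        fun _ _ => Complex.normSq_nonneg _).mp h0.symm z (Finset.mem_univ z)
      exact Complex.normSq_eq_zero.mp this
    have := Q.stateUtility_smul v 0 Ψ
    rw [zero_smul, map_zero, zero_mul] at this
    rw [hz, this]
    simp [ampNormSq]
  · set a : ℝ := Real.sqrt (ampNormSq Ψ)⁻¹
    have ha : Complex.normSq (a : ℂ) = (ampNormSq Ψ)⁻¹ := by
      rw [Complex.normSq_ofReal, Real.mul_self_sqrt (inv_nonneg.mpr hpos.le)]
    have h1 : ampNormSq ((a : ℂ) • Ψ) = 1 := by
      rw [ampNormSq_smul, ha, inv_mul_cancel₀ hpos.ne']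
    have h2 := hmax _ h1
    rw [stateUtility_smul, ha, inv_mul_le_iff₀ hpos] at h2
    linarith

/-- The states that are best responses of a buyer of type `v`. -/
def bestStates (v : BundleValuation n) : Set (Reg Q.len → ℂ) :=
  {Ψ | ampNormSq Ψ = 1 ∧ ∀ Φ, ampNormSq Φ = 1 → Q.stateUtility v Φ ≤ Q.stateUtility v Ψ}

/-- Maximize the utility over the unit sphere, then the payment over the compact set of maximizers.
The tie-breaking serves measurability; the revenue bound holds for every best response. -/
theorem exists_dearest_bestState (v : BundleValuation n) :
    ∃ Ψ ∈ Q.bestStates v, ∀ Φ ∈ Q.bestStates v, Q.statePayment Φ ≤ Q.statePayment Ψ := by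
  have hcomp := isCompact_unitVectors (Reg Q.len)
  have hu : Continuous (Q.stateUtility v) :=
    Q.continuous_stateUtility.comp (Continuous.prodMk_right v)
  have hne : {Ψ : Reg Q.len → ℂ | ampNormSq Ψ = 1}.Nonempty :=
    ⟨Pi.single 0 1, by simp [ampNormSq, Pi.single_apply, apply_ite Complex.normSq]⟩
  obtain ⟨Ψ₀, hΨ₀, hmax⟩ := hcomp.exists_isMaxOn hne hu.continuousOn
  have hbest : IsCompact (Q.bestStates v) := by
    have : Q.bestStates v = {Ψ | ampNormSq Ψ = 1} ∩
        ⋂ Φ ∈ {Φ : Reg Q.len → ℂ | ampNormSq Φ = 1},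
          {Ψ | Q.stateUtility v Φ ≤ Q.stateUtility v Ψ} := by
      ext Ψ
      simp [bestStates]
    rw [this]
    exact hcomp.inter_right (isClosed_biInter fun Φ _ => isClosed_le continuous_const hu)
  obtain ⟨Ψ, hΨ, hmax'⟩ := hbest.exists_isMaxOn ⟨Ψ₀, hΨ₀, fun Φ hΦ => hmax hΦ⟩
    Q.continuous_statePayment.continuousOn
  exact ⟨Ψ, hΨ, fun Φ hΦ => hmax' hΦ⟩

/-- A best response with the highest payment. -/
noncomputable def dearestState (v : BundleValuation n) : Reg Q.len → ℂ :=
  (Q.exists_dearest_bestState v).choose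

theorem dearestState_mem (v : BundleValuation n) : Q.dearestState v ∈ Q.bestStates v :=
  (Q.exists_dearest_bestState v).choose_spec.1

/-- The dearest best payment is upper semicontinuous: pairs of a type and a best response paying at
least `c` form a closed set, and its projection along the compact sphere is closed. No measurable
selection of states is needed. -/
theorem measurable_statePayment_dearestState (X : Set (BundleValuation n)) :
    Measurable fun v : X => Q.statePayment (Q.dearestState v.1) := by
  refine measurable_of_Ici fun c => IsClosed.measurableSet ?_
  have : CompactSpace {Ψ : Reg Q.len → ℂ | ampNormSq Ψ = 1} :=
    isCompact_iff_compactSpace.mp (isCompact_unitVectors _)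
  have hu : ∀ g : X × {Ψ : Reg Q.len → ℂ | ampNormSq Ψ = 1} → Reg Q.len → ℂ, Continuous g →
      Continuous fun p => Q.stateUtility p.1.1 (g p) := fun g hg =>
    Q.continuous_stateUtility.comp
      ((continuous_subtype_val.comp continuous_fst).prodMk hg)
  have hclosed : IsClosed ({p : X × {Ψ : Reg Q.len → ℂ | ampNormSq Ψ = 1} |
      c ≤ Q.statePayment p.2.1} ∩ ⋂ Φ ∈ {Φ : Reg Q.len → ℂ | ampNormSq Φ = 1},
        {p | Q.stateUtility p.1.1 Φ ≤ Q.stateUtility p.1.1 p.2.1}) :=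
    (isClosed_le continuous_const
      (Q.continuous_statePayment.comp (continuous_subtype_val.comp continuous_snd))).inter
      (isClosed_biInter fun Φ _ => isClosed_le (hu _ continuous_const)
        (hu _ (continuous_subtype_val.comp continuous_snd)))
  convert isClosedMap_fst_of_compactSpace _ hclosed using 1
  ext v
  simp only [Set.mem_preimage, Set.mem_Ici, Set.mem_image, Set.mem_inter_iff, Set.mem_ofPred_eq,
    Set.mem_iInter, Prod.exists, exists_and_right, exists_eq_right]
  constructor
  · intro h
    have hm := Q.dearestState_mem v.1
    exact ⟨⟨_, hm.1⟩, h, hm.2⟩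
  · rintro ⟨⟨Ψ, hΨ⟩, hc, hbest⟩
    exact hc.trans ((Q.exists_dearest_bestState v.1).choose_spec.2 Ψ ⟨hΨ, hbest⟩)

theorem abs_statePayment_le {Ψ : Reg Q.len → ℂ} (hΨ : ampNormSq Ψ = 1) :
    |Q.statePayment Ψ| ≤ Q.prob * ∑ r, |Q.price r| := by
  rw [statePayment, abs_mul, abs_of_pos Q.prob_pos]
  refine mul_le_mul_of_nonneg_left ?_ Q.prob_pos.le
  refine (Finset.abs_sum_le_sum_abs _ _).trans (Finset.sum_le_sum fun r _ => ?_)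
  rw [abs_mul, abs_of_nonneg (ampNormSq_nonneg _)]
  refine mul_le_of_le_one_right (abs_nonneg _) ?_
  rw [← hΨ, ← Q.sum_ampNormSq_test Ψ]
  exact Finset.single_le_sum (f := fun r => ampNormSq (Q.test r *ᵥ Ψ))
    (fun _ _ => ampNormSq_nonneg _) (Finset.mem_univ r)

/-- The quantum auction protocol in which the buyer is advised to send his dearest best response. -/
noncomputable def protocol (X : Set (BundleValuation n)) : QuantumAuctionProtocol X where
  seller := Q.seller
  suggested v := sender (Q.dearestState v.1) (Q.dearestState_mem v.1).1

variable (X : Set (BundleValuation n))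

theorem protocol_payment (v : X) :
    (Q.protocol X).payment v = Q.statePayment (Q.dearestState v.1) :=
  Q.expectedPayment_sender _ (Q.dearestState_mem v.1).1

theorem protocol_utility (v : X) :
    expectedUtility (Q.protocol X).seller ((Q.protocol X).suggested v) v.1 =
      Q.stateUtility v.1 (Q.dearestState v.1) :=
  Q.expectedUtility_sender _ (Q.dearestState_mem v.1).1 _

theorem protocol_isProper : (Q.protocol X).IsProper := fun s =>
  ⟨Q.hasSum_endProb s, (Q.hasSum_endProb_mul_sellerHistory s Q.seller.pay).summable⟩

theorem protocol_isIR (h : ∀ v ∈ X, ∃ Ψ, ampNormSq Ψ = 1 ∧ 0 ≤ Q.stateUtility v Ψ) :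
    (Q.protocol X).IsIR := fun v => by
  rw [protocol_utility]
  obtain ⟨Ψ, hΨ, h0⟩ := h v.1 v.2
  exact h0.trans ((Q.dearestState_mem v.1).2 Ψ hΨ)

theorem protocol_isIC {U : ℝ} (hv : ∀ v ∈ X, ∀ S, 0 ≤ v S ∧ v S ≤ U)
    (hfine : U + U / Q.prob ≤ Q.fine)
    (h : ∀ v ∈ X, ∃ Ψ, ampNormSq Ψ = 1 ∧ 0 ≤ Q.stateUtility v Ψ) :
    (Q.protocol X).IsIC := fun v s => by
  have h0 := Q.protocol_isIR X h v
  rw [protocol_utility] at h0 ⊢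
  exact Q.expectedUtility_le s v.1 (hv v.1 v.2) hfine h0
    fun Ψ => Q.stateUtility_le_mul v.1 (Q.dearestState_mem v.1).2 Ψ

theorem protocol_integrable (D : Measure X) [IsProbabilityMeasure D] :
    Integrable (Q.protocol X).payment D := by
  have : (Q.protocol X).payment = fun v : X => Q.statePayment (Q.dearestState v.1) :=
    funext (Q.protocol_payment X)
  rw [this]
  refine Integrable.of_bound
    (Q.measurable_statePayment_dearestState X).aestronglyMeasurable
    (Q.prob * ∑ r, |Q.price r|) (ae_of_all _ fun v => ?_)
  exact Q.abs_statePayment_le (Q.dearestState_mem v.1).1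

end RegisterAuction

/-! ### Auctions for a finite menu -/

/-- Every Hermitian operator is the expectation of the outcome of a measurement. -/
theorem exists_measurement_of_isHermitian {ι : Type} [Fintype ι] [DecidableEq ι]
    {P : Matrix ι ι ℂ} (hP : P.IsHermitian) :
    ∃ (T : ι → Matrix ι ι ℂ) (p : ι → ℝ), ∑ i, (T i)ᴴ * T i = 1 ∧
      ∀ Ψ : ι → ℂ, ((∑ i, p i * ampNormSq (T i *ᵥ Ψ) : ℝ) : ℂ) = star Ψ ⬝ᵥ (P *ᵥ Ψ) := by
  set V : Matrix ι ι ℂ := (hP.eigenvectorUnitary : Matrix ι ι ℂ) with hV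
  have hVV : V * Vᴴ = 1 := (Matrix.mem_unitaryGroup_iff).mp hP.eigenvectorUnitary.2
  have hT : ∀ i, (Matrix.single i i (1 : ℂ) * Vᴴ)ᴴ * (Matrix.single i i (1 : ℂ) * Vᴴ) =
      V * ((Matrix.single i i (1 : ℂ))ᴴ * Matrix.single i i 1) * Vᴴ := fun i => by
    rw [Matrix.conjTranspose_mul, Matrix.conjTranspose_conjTranspose]
    simp only [Matrix.mul_assoc]
  have hsum : ∀ c : ι → ℂ, ∑ i, c i • ((Matrix.single i i (1 : ℂ) * Vᴴ)ᴴ *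
      (Matrix.single i i (1 : ℂ) * Vᴴ)) = V * Matrix.diagonal c * Vᴴ := fun c => by
    rw [← sum_single_conj, Finset.mul_sum, Finset.sum_mul]
    refine Finset.sum_congr rfl fun i _ => ?_
    rw [hT, Matrix.mul_smul, Matrix.smul_mul]
  have hspec : P = V * Matrix.diagonal (fun i => (hP.eigenvalues i : ℂ)) * Vᴴ := by
    conv_lhs => rw [hP.spectral_theorem, Unitary.conjStarAlgAut_apply]
    rfl
  refine ⟨fun i => Matrix.single i i 1 * Vᴴ, hP.eigenvalues, ?_, fun Ψ => ?_⟩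
  · have := hsum fun _ => 1
    simpa [hVV] using this
  · conv_rhs => rw [hspec, ← hsum, Matrix.sum_mulVec, dotProduct_sum]
    rw [Complex.ofReal_sum]
    refine Finset.sum_congr rfl fun i _ => ?_
    rw [Matrix.smul_mulVec, dotProduct_smul, star_dotProduct_conjTranspose_mul_mulVec,
      smul_eq_mul, Complex.ofReal_mul]

/-- The operator that charges `a j` in the sector `j`, and the penalty `K` if the state of the
sector is found to be different from `ψ j`. -/
noncomputable def menuOp {R J : Type} [DecidableEq R] [DecidableEq J]
    (ψ : J → R → ℂ) (a : J → ℝ) (K : ℝ) : Matrix (R × J) (R × J) ℂ :=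
  Matrix.blockDiagonal fun j => ((a j + K : ℝ) : ℂ) • 1 - (K : ℂ) • pureState (ψ j)

theorem menuOp_isHermitian {R J : Type} [DecidableEq R] [DecidableEq J]
    (ψ : J → R → ℂ) (a : J → ℝ) (K : ℝ) : (menuOp ψ a K).IsHermitian := by
  rw [Matrix.IsHermitian, menuOp, Matrix.blockDiagonal_conjTranspose]
  congr 1
  ext1 j
  rw [Matrix.conjTranspose_sub, Matrix.conjTranspose_smul, Matrix.conjTranspose_smul,
    Matrix.conjTranspose_one, pureState, Matrix.conjTranspose_vecMulVec, star_star]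
  simp

/-- The observable is block diagonal, so each sector contributes separately. For a unit vector `ψ j`
the factor of `K` is the squared norm of the component of the sector orthogonal to `ψ j`. -/
theorem menuOp_form {R J : Type} [Fintype R] [Fintype J] [DecidableEq R] [DecidableEq J]
    (ψ : J → R → ℂ) (a : J → ℝ) (K : ℝ) (Ψ : R × J → ℂ) :
    star Ψ ⬝ᵥ (menuOp ψ a K *ᵥ Ψ) =
      ((∑ j, (a j * ampNormSq (fun r => Ψ (r, j)) + K * (ampNormSq (fun r => Ψ (r, j)) -
        Complex.normSq (star (ψ j) ⬝ᵥ fun r => Ψ (r, j)))) : ℝ) : ℂ) := by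
  have h1 : star Ψ ⬝ᵥ (menuOp ψ a K *ᵥ Ψ) = ∑ j, star (fun r => Ψ (r, j)) ⬝ᵥ
      ((((a j + K : ℝ) : ℂ) • 1 - (K : ℂ) • pureState (ψ j)) *ᵥ fun r => Ψ (r, j)) := by
    simp only [dotProduct, Matrix.mulVec, menuOp, Matrix.blockDiagonal_apply,
      Fintype.sum_prod_type_right]
    refine Finset.sum_congr rfl fun j _ => Finset.sum_congr rfl fun r _ => ?_
    congr 1
    rw [Finset.sum_eq_single j]
    · simp
    · intro j' _ hj
      exact Finset.sum_eq_zero fun r' _ => by simp [hj.symm]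
    · simp
  rw [h1, Complex.ofReal_sum]
  refine Finset.sum_congr rfl fun j _ => ?_
  set φ : R → ℂ := fun r => Ψ (r, j)
  have h2 : star φ ⬝ᵥ ψ j = star (star (ψ j) ⬝ᵥ φ) :=
    Matrix.star_dotProduct _ _
  rw [Matrix.sub_mulVec, dotProduct_sub, Matrix.smul_mulVec, Matrix.smul_mulVec,
    dotProduct_smul, dotProduct_smul, Matrix.one_mulVec, star_dotProduct_self, pureState,
    Matrix.vecMulVec_mulVec, dotProduct_smul, h2]
  simp only [smul_eq_mul, Complex.ofReal_add, Complex.ofReal_mul, Complex.ofReal_sub,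
    Complex.normSq_eq_conj_mul_self, MulOpposite.smul_eq_mul_unop, MulOpposite.unop_op,
    RCLike.star_def]
  ring

/-- For each menu of unit vectors with prices there is an auction whose payoffs are those of the
buyer's state, decomposed into sectors, at the menu prices. -/
theorem exists_menuAuction {n k m : ℕ} (hk : 1 ≤ k) (hm : 1 ≤ m) {ε : ℝ} (hε : 0 < ε)
    (hε1 : ε ≤ 1) (b : Reg k → Finset (Fin n)) (S₀ : Finset (Fin n)) (ψ : Reg m → Reg k → ℂ)
    (a : Reg m → ℝ) (K fine : ℝ) :
    ∃ Q : RegisterAuction n, Q.cut = k ∧ Q.len = k + m ∧ Q.prob = ε ∧ Q.fine = fine ∧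
      ∃ sector : (Reg Q.len → ℂ) → Reg m → Reg k → ℂ, Function.Surjective sector ∧
        ∀ Ψ, ampNormSq Ψ = ∑ j, ampNormSq (sector Ψ j) ∧
          Q.statePayment Ψ = ∑ j, (a j * ampNormSq (sector Ψ j) + K * (ampNormSq (sector Ψ j) -
            Complex.normSq (star (ψ j) ⬝ᵥ sector Ψ j))) ∧
          ∀ v : BundleValuation n, Q.stateUtility v Ψ =
            (1 - ε) * ∑ j, ∑ r, v (b r) * Complex.normSq (sector Ψ j r) +
              ε * (v S₀ * ampNormSq Ψ) - Q.statePayment Ψ := by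
  -- Register labels are pairs of a bundle code, held by the seller at the cut, and a menu index.
  set e := Fin.appendEquiv (α := Fin 2) k m
  obtain ⟨T, p, hT, hp⟩ := exists_measurement_of_isHermitian
    ((menuOp_isHermitian ψ a K).submatrix e.symm)
  let Q : RegisterAuction n :=
    { cut := k
      len := k + m
      cut_pos := hk
      cut_lt := by omega
      prob := ε
      prob_pos := hε
      prob_le := hε1
      bundle := fun z => b (e.symm z).1
      bundle_congr := fun z z' h => by
        congr 1
        ext i
        exact congrArg Fin.val (h (Fin.castAdd m i) i.isLt)
      fallback := S₀
      test := T
      test_complete := hT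
      -- The audit has probability `ε`, so expected payments are the eigenvalue averages themselves.
      price := fun i => p i / ε
      fine := fine }
  have hsum : ∀ f : Reg (k + m) → ℝ, ∑ z, f z = ∑ j, ∑ r, f (e (r, j)) := fun f => by
    rw [← e.sum_comp, Fintype.sum_prod_type_right]
  refine ⟨Q, rfl, rfl, rfl, rfl, fun Ψ j r => Ψ (e (r, j)), ?_, fun Ψ => ⟨hsum _, ?_, fun v => ?_⟩⟩
  · intro Φ
    refine ⟨fun z => Φ (e.symm z).2 (e.symm z).1, ?_⟩
    ext j r
    simp
  · have h1 : Q.statePayment Ψ = ∑ i, p i * ampNormSq (T i *ᵥ Ψ) := by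
      rw [RegisterAuction.statePayment, Finset.mul_sum]
      refine Finset.sum_congr rfl fun i _ => ?_
      change ε * (p i / ε * ampNormSq (T i *ᵥ Ψ)) = _
      field_simp
    have h2 := hp Ψ
    rw [Matrix.submatrix_mulVec_equiv, dotProduct_comp_equiv_symm] at h2
    have h3 := menuOp_form ψ a K (Ψ ∘ e)
    rw [h1]
    exact_mod_cast h2.trans h3
  · have h5 := Q.sum_ampNormSq_test Ψ
    have h6 : ∑ r, (v Q.fallback - Q.price r) * ampNormSq (Q.test r *ᵥ Ψ) =
        v S₀ * ampNormSq Ψ - ∑ r, Q.price r * ampNormSq (Q.test r *ᵥ Ψ) := by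
      rw [← h5, Finset.mul_sum, ← Finset.sum_sub_distrib]
      exact Finset.sum_congr rfl fun r _ => by ring
    rw [RegisterAuction.stateUtility, h6, RegisterAuction.statePayment, mul_sub, add_sub_assoc]
    congr 2
    refine (hsum _).trans ?_
    refine Finset.sum_congr rfl fun j _ => Finset.sum_congr rfl fun r _ => ?_
    change v (b (e.symm (e (r, j))).1) * _ = _
    rw [e.symm_apply_apply]

/-! ### Deviations from a menu entry -/

/-- The penalty outweighs what a state different from `ψ` can gain. -/
theorem sum_mul_normSq_le {R : Type} [Fintype R] {ψ : R → ℂ} (hψ : ampNormSq ψ = 1) (φ : R → ℂ)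
    {w : R → ℝ} {U s K : ℝ} (hw : ∀ r, 0 ≤ w r ∧ w r ≤ U) (hs : 0 < s)
    (hK : (1 + 1 / s) * U ≤ K) :
    ∑ r, w r * Complex.normSq (φ r) ≤
      ampNormSq φ * (∑ r, w r * Complex.normSq (ψ r) + s * U) +
        K * (ampNormSq φ - Complex.normSq (star ψ ⬝ᵥ φ)) ∧
      0 ≤ ampNormSq φ - Complex.normSq (star ψ ⬝ᵥ φ) := by
  set α := star ψ ⬝ᵥ φ with hα
  -- The component orthogonal to `ψ`; its squared norm is what the penalty is charged on.
  set χ : R → ℂ := φ - α • ψ with hχ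
  have hnorm : ampNormSq χ = ampNormSq φ - Complex.normSq α := by
    have h : (ampNormSq χ : ℂ) = ((ampNormSq φ - Complex.normSq α : ℝ) : ℂ) := by
      have h2 : star φ ⬝ᵥ ψ = star α :=
        Matrix.star_dotProduct _ _
      rw [← star_dotProduct_self, hχ, star_sub, star_smul, sub_dotProduct, dotProduct_sub,
        dotProduct_sub, dotProduct_smul, smul_dotProduct, smul_dotProduct, dotProduct_smul,
        star_dotProduct_self, star_dotProduct_self, hψ, ← hα, h2]
      simp only [smul_eq_mul, Complex.ofReal_sub, Complex.normSq_eq_conj_mul_self,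
        RCLike.star_def]
      simp
      ring
    exact_mod_cast h
  have hχ0 := ampNormSq_nonneg χ
  rw [← hnorm]
  refine ⟨?_, hχ0⟩
  -- The cross term is split with weights `s` and `1 / s`: interference with `ψ` costs a factor `1 +
  -- s` near one, and the large factor `1 + 1 / s` falls on `χ`, where `K` absorbs it.
  have hpt : ∀ r, Complex.normSq (φ r) ≤ (1 + s) * (Complex.normSq α * Complex.normSq (ψ r)) +
      (1 + 1 / s) * Complex.normSq (χ r) := by
    intro r
    have hφ : φ r = α * ψ r + χ r := by simp [hχ]
    rw [hφ, ← Complex.normSq_mul]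
    simp only [Complex.normSq_apply, Complex.add_re, Complex.add_im]
    set x := (α * ψ r).re
    set y := (α * ψ r).im
    set x' := (χ r).re
    set y' := (χ r).im
    have key : ∀ p q : ℝ, 2 * p * q ≤ s * (p * p) + 1 / s * (q * q) := fun p q => by
      have h1 : s * (p * p) + 1 / s * (q * q) - 2 * p * q = (s * p - q) ^ 2 / s := by
        field_simp
        ring
      have h2 : 0 ≤ (s * p - q) ^ 2 / s := by positivity
      linarith
    nlinarith [key x x', key y y']
  have hψw : ∑ r, w r * Complex.normSq (ψ r) ≤ U := by
    calc ∑ r, w r * Complex.normSq (ψ r) ≤ ∑ r, U * Complex.normSq (ψ r) :=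
          Finset.sum_le_sum fun r _ =>
            mul_le_mul_of_nonneg_right (hw r).2 (Complex.normSq_nonneg _)
      _ = U := by rw [← Finset.mul_sum, ← ampNormSq, hψ, mul_one]
  have hψ0 : 0 ≤ ∑ r, w r * Complex.normSq (ψ r) :=
    Finset.sum_nonneg fun r _ => mul_nonneg (hw r).1 (Complex.normSq_nonneg _)
  have hα0 := Complex.normSq_nonneg α
  calc ∑ r, w r * Complex.normSq (φ r)
      ≤ ∑ r, (((1 + s) * Complex.normSq α) * (w r * Complex.normSq (ψ r)) +
          (1 + 1 / s) * U * Complex.normSq (χ r)) := by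
        refine Finset.sum_le_sum fun r _ => ?_
        have h1 := mul_le_mul_of_nonneg_left (hpt r) (hw r).1
        have h2 : w r * ((1 + 1 / s) * Complex.normSq (χ r)) ≤
            U * ((1 + 1 / s) * Complex.normSq (χ r)) :=
          mul_le_mul_of_nonneg_right (hw r).2
            (mul_nonneg (by positivity) (Complex.normSq_nonneg _))
        linarith
    _ = (1 + s) * Complex.normSq α * ∑ r, w r * Complex.normSq (ψ r) +
          (1 + 1 / s) * U * ampNormSq χ := by
        rw [Finset.sum_add_distrib, ← Finset.mul_sum, ← Finset.mul_sum, ampNormSq]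
    _ ≤ ampNormSq φ * (∑ r, w r * Complex.normSq (ψ r) + s * U) + K * ampNormSq χ := by
        have h1 := mul_le_mul_of_nonneg_right hK hχ0
        have h2 : Complex.normSq α ≤ ampNormSq φ := by linarith
        have h3 := mul_le_mul_of_nonneg_right h2
          (add_nonneg hψ0 (mul_nonneg hs.le hψ0))
        have h4 := mul_le_mul_of_nonneg_left (mul_le_mul_of_nonneg_left hψw hs.le)
          (hα0.trans h2)
        linarith

/-! ### Approximate revenue maximization -/

namespace Mechanism

variable {n : ℕ} {X : Set (BundleValuation n)} (M : Mechanism X)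

theorem alloc_le_one (v : X) (S : Finset (Fin n)) : M.alloc v S ≤ 1 := by
  rw [← M.alloc_sum v]
  exact Finset.single_le_sum (fun T _ => M.alloc_nonneg v T) (Finset.mem_univ S)

theorem pay_le (hIR : M.IsIR) {U : ℝ} (hU : ∀ v ∈ X, ∀ S, 0 ≤ v S ∧ v S ≤ U) (v : X) :
    M.pay v ≤ U := by
  have h := hIR v
  have h1 : ∑ S, M.alloc v S * v.1 S ≤ ∑ S, M.alloc v S * U :=
    Finset.sum_le_sum fun S _ => mul_le_mul_of_nonneg_left (hU v v.2 S).2 (M.alloc_nonneg v S)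
  rw [← Finset.sum_mul, M.alloc_sum, one_mul] at h1
  rw [utility] at h
  linarith

/-- Finitely many entries approximate the whole menu of a mechanism. -/
theorem exists_net [Nonempty X] (hIR : M.IsIR) {U : ℝ} (hU : ∀ v ∈ X, ∀ S, 0 ≤ v S ∧ v S ≤ U)
    {η : ℝ} (hη : 0 < η) : ∃ m, 1 ≤ m ∧ ∃ τ : Reg m → X, ∀ v, ∃ j,
      (∀ S, |M.alloc v S - M.alloc (τ j) S| ≤ η) ∧ |M.pay v - M.pay (τ j)| ≤ η := by
  set a : X → (Finset (Fin n) → ℝ) × ℝ := fun v => (M.alloc v, M.pay v)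
  have hb : TotallyBounded (Set.range a) := by
    refine TotallyBounded.subset ?_
      (isCompact_Icc (a := ((fun _ => 0, 0) : (Finset (Fin n) → ℝ) × ℝ))
        (b := (fun _ => 1, U))).totallyBounded
    rintro _ ⟨v, rfl⟩
    exact ⟨⟨fun S => M.alloc_nonneg v S, M.pay_nonneg v⟩,
      ⟨fun S => M.alloc_le_one v S, M.pay_le hIR hU v⟩⟩
  obtain ⟨t, hts, hfin, hcov⟩ := Metric.finite_approx_of_totallyBounded hb η hη
  have : Fintype t := hfin.fintype
  have hnear : ∀ v, ∃ y ∈ t, dist (a v) y < η := fun v => by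
    simpa using hcov (Set.mem_range_self v)
  have : Nonempty t := by
    obtain ⟨y, hy, -⟩ := hnear (Classical.arbitrary X)
    exact ⟨⟨y, hy⟩⟩
  choose ρ hρ using fun y : t => hts y.2
  -- The added qubit ensures `1 ≤ m`, so that the cut comes strictly before the end. Superfluous
  -- labels are sent to net points by `Function.invFun`.
  set m := Nat.clog 2 (Fintype.card t) + 1
  have hcard : Fintype.card t ≤ Fintype.card (Reg m) := by
    rw [Fintype.card_fun, Fintype.card_fin, Fintype.card_fin]
    exact (Nat.le_pow_clog one_lt_two _).trans (Nat.pow_le_pow_right two_pos (Nat.le_succ _))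
  obtain ⟨f⟩ := Function.Embedding.nonempty_of_card_le hcard
  refine ⟨m, by omega, fun j => ρ (Function.invFun f j), fun v => ?_⟩
  obtain ⟨y, hy, hd⟩ := hnear v
  refine ⟨f ⟨y, hy⟩, ?_⟩
  beta_reduce
  rw [Function.leftInverse_invFun f.injective]
  have h1 : a (ρ ⟨y, hy⟩) = y := hρ ⟨y, hy⟩
  rw [← h1, Prod.dist_eq, max_lt_iff] at hd
  refine ⟨fun S => ?_, ?_⟩
  · rw [← Real.dist_eq]
    exact (dist_le_pi_dist (M.alloc v) (M.alloc (ρ ⟨y, hy⟩)) S).trans hd.1.le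
  · rw [← Real.dist_eq]
    exact hd.2.le

/-- The bundles of a family of size at most `2 ^ k` can be encoded into `k` qubits. -/
theorem exists_encoding {𝓑 : Finset (Finset (Fin n))} (h𝓑 : M.AllocatesOnly 𝓑) {k : ℕ}
    (hk : 𝓑.card ≤ 2 ^ k) : ∃ (b : Reg k → Finset (Fin n)) (x : X → Reg k → ℝ),
      (∀ v r, 0 ≤ x v r) ∧
        ∀ (v : X) (f : Finset (Fin n) → ℝ), ∑ r, f (b r) * x v r = ∑ S, M.alloc v S * f S := by
  have hcard : Fintype.card 𝓑 ≤ Fintype.card (Reg k) := by simpa using hk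
  obtain ⟨e⟩ := Function.Embedding.nonempty_of_card_le hcard
  -- Codes without a bundle stand for `∅` and have probability `0`.
  refine ⟨Function.extend e Subtype.val fun _ => ∅,
    fun v => Function.extend e (fun S => M.alloc v S.1) 0, fun v r => ?_, fun v f => ?_⟩
  · beta_reduce
    by_cases h : ∃ S, e S = r
    · obtain ⟨S, rfl⟩ := h
      rw [e.injective.extend_apply]
      exact M.alloc_nonneg v S.1
    · rw [Function.extend_apply' _ _ _ h]
      exact le_rfl
  · have h1 : ∑ S : 𝓑, M.alloc v S.1 * f S.1 = ∑ S, M.alloc v S * f S := by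
      rw [Finset.sum_coe_sort 𝓑 fun S => M.alloc v S * f S]
      exact Finset.sum_subset (Finset.subset_univ _) fun S _ hS => by rw [h𝓑 v S hS, zero_mul]
    rw [← h1]
    symm
    refine Fintype.sum_of_injective e e.injective _ _ ?_ ?_
    · intro r hr
      beta_reduce
      rw [Function.extend_apply' (fun S : 𝓑 => M.alloc v S.1) _ _ (fun ⟨S, hS⟩ => hr ⟨S, hS⟩)]
      simp
    · intro S
      beta_reduce
      rw [e.injective.extend_apply, e.injective.extend_apply, mul_comm]

/-- For type `v`, compare a best response, with weights `q j` on the sectors, with announcing a net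
point near `v`. The comparison and incentive compatibility of `M` give `γ * M.pay v ≤ γ * ∑ j, q j *
M.pay (τ j) + 2 * θ`; the discount `γ` is what makes payments visible here. -/
theorem exists_approximating_protocol [Nonempty X] (hIC : M.IsIC) (hIR : M.IsIR) {U : ℝ}
    (hU : ∀ v ∈ X, ∀ S, 0 ≤ v S ∧ v S ≤ U) {𝓑 : Finset (Finset (Fin n))}
    (h𝓑 : M.AllocatesOnly 𝓑) {k : ℕ} (hk : 1 ≤ k) (hcard : 𝓑.card ≤ 2 ^ k) {γ θ : ℝ}
    (hγ : 0 < γ) (hγ1 : γ < 1) (hθ : 0 < θ) :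
    ∃ P : QuantumAuctionProtocol X, P.IsProper ∧ P.IsIC ∧ P.IsIR ∧
      (∀ (D : Measure X) [IsProbabilityMeasure D], Integrable P.payment D) ∧
      (∀ v, (1 - γ) ^ 2 * M.pay v - (2 * θ / γ + θ) ≤ P.payment v) ∧
      ∀ s, expectedQubits P.seller s ≤ ENNReal.ofReal (2 * k + 1) := by
  have hU0 : 0 ≤ U := by
    obtain ⟨v⟩ := ‹Nonempty X›
    exact (hU v v.2 ∅).1.trans (hU v v.2 ∅).2
  set N : ℝ := ((Fintype.card (Finset (Fin n)) : ℕ) : ℝ) with hN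
  have hN1 : 1 ≤ N := by
    rw [hN]
    exact_mod_cast Fintype.card_pos
  -- Replacing a type's entry by a net point costs at most `N * U * η` in value and `η` in price,
  -- together `θ`. The same `η` serves as the parameter `s` of the deviation bound, whose loss `η *
  -- U` is again at most `θ`.
  set η : ℝ := θ / (N * U + 1) with hη
  have hNU : 0 < N * U + 1 := by positivity
  have hη0 : 0 < η := by positivity
  have hηθ : N * U * η + η = θ := by
    rw [hη]
    field_simp
  have hηU : η * U ≤ θ := by
    linarith [mul_nonneg (mul_nonneg hη0.le hU0) (sub_nonneg.mpr hN1)]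
  obtain ⟨m, hm, τ, hτ⟩ := M.exists_net hIR hU hη0
  obtain ⟨b, x, hx0, hx⟩ := M.exists_encoding h𝓑 hcard
  -- The second bound makes the audit branch cost at most one qubit in expectation, whatever `m` is;
  -- the first keeps the lost revenue factor `1 - ε` above `1 - γ`.
  set ε : ℝ := min γ (1 / (2 * (k + m : ℕ) + 1)) with hε
  have hε0 : 0 < ε := lt_min hγ (by positivity)
  have hεγ : ε ≤ γ := min_le_left _ _
  have hε1 : 0 < 1 - ε := by linarith
  have hεL : ε * (2 * (k + m : ℕ) + 1) ≤ 1 := by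
    rw [← le_div_iff₀ (by positivity)]
    exact min_le_right _ _
  set ψ : Reg m → Reg k → ℂ := fun j r => (Real.sqrt (x (τ j) r) : ℂ)
  have hψr : ∀ j r, Complex.normSq (ψ j r) = x (τ j) r := fun j r => by
    rw [Complex.normSq_ofReal, Real.mul_self_sqrt (hx0 _ _)]
  have hψ : ∀ j, ampNormSq (ψ j) = 1 := fun j => by
    have := hx (τ j) fun _ => 1
    simp only [one_mul, mul_one, M.alloc_sum] at this
    simpa only [ampNormSq, hψr] using this
  -- The factor `1 - γ` steers towards dear entries; the rebate `θ` pays for rounding to the net and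
  -- so keeps individual rationality exact.
  set p : Reg m → ℝ := fun j => (1 - γ) * M.pay (τ j) - θ with hp
  set K : ℝ := (1 + 1 / η) * U
  have hK : 0 ≤ K := by positivity
  obtain ⟨Q, hcut, hlen, hprob, hfine, sector, hsurj, hsector⟩ := exists_menuAuction hk hm hε0
    (by linarith) b ∅ ψ (fun j => (1 - ε) * p j) K (U + U / ε)
  set A : X → X → ℝ := fun v w => ∑ S, M.alloc w S * v.1 S with hA
  have hAval : ∀ (v : X) j, ∑ r, v.1 (b r) * Complex.normSq (ψ j r) = A v (τ j) := fun v j => by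
    simp only [hψr]
    exact hx (τ j) v.1
  have honest : ∀ (v : X) j, ∃ Ψ, ampNormSq Ψ = 1 ∧
      Q.stateUtility v.1 Ψ = (1 - ε) * (A v (τ j) - p j) + ε * v.1 ∅ := by
    intro v j
    obtain ⟨Ψ, hΨ⟩ := hsurj (Pi.single j (ψ j))
    obtain ⟨h1, h2, h3⟩ := hsector Ψ
    have hne : ∀ i, i ≠ j → sector Ψ i = 0 := fun i hi => by
      rw [hΨ, Pi.single_eq_of_ne hi]
    have hj : sector Ψ j = ψ j := by rw [hΨ, Pi.single_eq_same]
    have hz : ampNormSq (0 : Reg k → ℂ) = 0 := by simp [ampNormSq]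
    rw [Finset.sum_eq_single j (fun i _ hi => by rw [hne i hi, hz]) (by simp), hj, hψ] at h1
    rw [Finset.sum_eq_single j (fun i _ hi => by rw [hne i hi, hz, dotProduct_zero]; simp)
      (by simp), hj, hψ, star_dotProduct_self, hψ] at h2
    refine ⟨Ψ, h1, ?_⟩
    rw [h3 v.1, h2, h1, Finset.sum_eq_single j (fun i _ hi => by rw [hne i hi]; simp) (by simp),
      hj, hAval]
    simp
    ring
  -- The first inequality gives individual rationality; the second, which keeps the discount, gives
  -- revenue.
  have hclose : ∀ v : X, ∃ j, A v v - M.pay v ≤ A v (τ j) - p j ∧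
      A v v - (1 - γ) * M.pay v - θ ≤ A v (τ j) - (1 - γ) * M.pay (τ j) := by
    intro v
    obtain ⟨j, hj1, hj2⟩ := hτ v
    have h1 : A v v - A v (τ j) ≤ N * U * η := by
      calc A v v - A v (τ j) = ∑ S, (M.alloc v S - M.alloc (τ j) S) * v.1 S := by
            rw [hA, ← Finset.sum_sub_distrib]
            exact Finset.sum_congr rfl fun S _ => by ring
        _ ≤ ∑ _S : Finset (Fin n), η * U := by
            refine Finset.sum_le_sum fun S _ => ?_
            have hS := hU v v.2 S
            exact (mul_le_mul_of_nonneg_right ((le_abs_self _).trans (hj1 S)) hS.1).trans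
              (mul_le_mul_of_nonneg_left hS.2 hη0.le)
        _ = N * U * η := by
            rw [Finset.sum_const, Finset.card_univ, nsmul_eq_mul]
            ring
    have h2 := abs_le.mp hj2
    have h3 := M.pay_nonneg (τ j)
    have h4 : (1 - γ) * (M.pay (τ j) - M.pay v) ≤ η := by
      have h5 := mul_le_mul_of_nonneg_left (by linarith : M.pay (τ j) - M.pay v ≤ η)
        (by linarith : 0 ≤ 1 - γ)
      linarith [mul_nonneg hγ.le hη0.le]
    refine ⟨j, ?_, by linarith⟩
    simp only [hp]
    linarith [mul_nonneg hγ.le h3]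
  have hIR' : ∀ v ∈ X, ∃ Ψ, ampNormSq Ψ = 1 ∧ 0 ≤ Q.stateUtility v Ψ := by
    intro v hv
    obtain ⟨j, hj, -⟩ := hclose ⟨v, hv⟩
    obtain ⟨Ψ, hΨ, hu⟩ := honest ⟨v, hv⟩ j
    refine ⟨Ψ, hΨ, ?_⟩
    rw [hu]
    have h1 := hIR ⟨v, hv⟩
    have h2 : 0 ≤ A ⟨v, hv⟩ (τ j) - p j := h1.trans hj
    have h3 := (hU v hv ∅).1
    positivity
  refine ⟨Q.protocol X, Q.protocol_isProper X, Q.protocol_isIC X hU ?_ hIR',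
    Q.protocol_isIR X hIR', fun D _ => Q.protocol_integrable X D, fun v => ?_, fun s => ?_⟩
  · rw [hfine, hprob]
  · rw [Q.protocol_payment]
    obtain ⟨hΨ, hbest⟩ := Q.dearestState_mem v.1
    set Ψ := Q.dearestState v.1
    obtain ⟨h1, h2, h3⟩ := hsector Ψ
    rw [hΨ] at h1
    set q : Reg m → ℝ := fun j => ampNormSq (sector Ψ j)
    have hq0 : ∀ j, 0 ≤ q j := fun j => ampNormSq_nonneg _
    have hslice := fun j => sum_mul_normSq_le (hψ j) (sector Ψ j)
      (fun r => hU v.1 v.2 (b r)) hη0 (le_refl K)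
    -- Penalties only add to the payment.
    have hpay : (1 - ε) * ∑ j, q j * p j ≤ Q.statePayment Ψ := by
      rw [h2, Finset.mul_sum]
      refine Finset.sum_le_sum fun j _ => ?_
      have := mul_nonneg hK (hslice j).2
      simp only [q] at *
      linarith
    -- Each sector gains at most `q j * (η * U)` net of its penalty, and the weights `q j` sum to
    -- one. Charging the penalty in full leaves a surplus `ε * K * (…)`, which is dropped.
    have hutil : Q.stateUtility v.1 Ψ ≤
        (1 - ε) * (∑ j, q j * (A v (τ j) - p j) + η * U) + ε * v.1 ∅ := by
      have h4 : (1 - ε) * ∑ j, ∑ r, v.1 (b r) * Complex.normSq (sector Ψ j r) -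
          Q.statePayment Ψ ≤ ∑ j, (1 - ε) * (q j * (A v (τ j) - p j) + q j * (η * U)) := by
        rw [h2, Finset.mul_sum, ← Finset.sum_sub_distrib]
        refine Finset.sum_le_sum fun j _ => ?_
        obtain ⟨h5, h6⟩ := hslice j
        rw [hAval] at h5
        have h7 := mul_le_mul_of_nonneg_left h5 hε1.le
        have h8 := mul_nonneg hε0.le (mul_nonneg hK h6)
        simp only [q] at *
        linarith
      rw [← Finset.mul_sum, Finset.sum_add_distrib, ← Finset.sum_mul, ← h1, one_mul] at h4
      rw [h3 v.1, hΨ]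
      linarith
    obtain ⟨j, -, hj⟩ := hclose v
    obtain ⟨Φ, hΦ, hu⟩ := honest v j
    have h9 := hbest Φ hΦ
    rw [hu] at h9
    have h10 : A v (τ j) - p j ≤ ∑ j, q j * (A v (τ j) - p j) + η * U := by
      refine le_of_mul_le_mul_left ?_ hε1
      linarith
    have hsplit : ∑ j, q j * (A v (τ j) - p j) =
        ∑ j, q j * (A v (τ j) - M.pay (τ j)) + γ * ∑ j, q j * M.pay (τ j) + θ := by
      have h11 : θ = ∑ j, q j * θ := by rw [← Finset.sum_mul, ← h1, one_mul]
      conv_rhs => rw [h11]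
      rw [Finset.mul_sum, ← Finset.sum_add_distrib, ← Finset.sum_add_distrib]
      refine Finset.sum_congr rfl fun i _ => ?_
      simp only [hp]
      ring
    have hICv : ∑ j, q j * (A v (τ j) - M.pay (τ j)) ≤ A v v - M.pay v := by
      calc ∑ j, q j * (A v (τ j) - M.pay (τ j)) ≤ ∑ j, q j * (A v v - M.pay v) :=
            Finset.sum_le_sum fun j _ => mul_le_mul_of_nonneg_left (hIC v (τ j)) (hq0 j)
        _ = A v v - M.pay v := by rw [← Finset.sum_mul, ← h1, one_mul]
    have hmain : M.pay v - 2 * θ / γ ≤ ∑ j, q j * M.pay (τ j) := by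
      have h12 : γ * M.pay v - 2 * θ ≤ γ * ∑ j, q j * M.pay (τ j) := by
        rw [hsplit] at h10
        simp only [hp] at h10
        linarith
      have h13 : γ * (M.pay v - 2 * θ / γ) = γ * M.pay v - 2 * θ := by
        field_simp
      refine le_of_mul_le_mul_left ?_ hγ
      rw [h13]
      exact h12
    have hqp : ∑ j, q j * p j = (1 - γ) * ∑ j, q j * M.pay (τ j) - θ := by
      have h11 : θ = ∑ j, q j * θ := by rw [← Finset.sum_mul, ← h1, one_mul]
      conv_rhs => rw [h11]
      rw [Finset.mul_sum, ← Finset.sum_sub_distrib]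
      refine Finset.sum_congr rfl fun i _ => ?_
      simp only [hp]
      ring
    refine le_trans ?_ hpay
    rw [hqp]
    have hγ' : 0 ≤ 1 - γ := by linarith
    have hE : 0 ≤ 2 * θ / γ := by positivity
    have hpv := M.pay_nonneg v
    have h14 := mul_le_mul_of_nonneg_left hmain hγ'
    have h15 : (1 - γ) * M.pay v - (2 * θ / γ + θ) ≤
        (1 - γ) * ∑ j, q j * M.pay (τ j) - θ := by
      linarith [mul_nonneg hγ.le hE]
    have h16 := mul_le_mul_of_nonneg_left h15 hε1.le
    have h17 : 0 ≤ (γ - ε) * ((1 - γ) * M.pay v) :=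
      mul_nonneg (sub_nonneg.mpr hεγ) (mul_nonneg hγ' hpv)
    have h18 : 0 ≤ ε * (2 * θ / γ + θ) := by positivity
    linarith
  · refine (Q.expectedQubits_le s).trans (ENNReal.ofReal_le_ofReal ?_)
    rw [hcut, hlen, hprob]
    linarith

end Mechanism

/-! ### The posted price protocol -/

/-- The seller's strategy that gives away the bundle `S` at the price `p` without communication. -/
abbrev postedPriceSeller {n : ℕ} (S : Finset (Fin n)) (p : ℝ) : SellerStrategy n where
  mem := 0
  meas _ := ⟨1, fun _ => 1, by simp⟩
  halt _ := true
  alloc _ := S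
  pay _ := p

section PostedPrice

variable {n : ℕ} (S : Finset (Fin n)) (p : ℝ)

theorem endProb_postedPriceSeller (s : BuyerStrategy) (e : Ending) :
    endProb (postedPriceSeller S p) s e = if e = ([], 0, none) then 1 else 0 := by
  obtain ⟨h, x, o⟩ := e
  have hcons : ∀ q h, stateAfter (postedPriceSeller S p) s (q :: h) = 0 := fun q h => by
    rw [stateAfter, if_pos (by simp)]
  cases o with
  | some y => simp [endProb]
  | none =>
    rw [endProb, if_pos rfl]
    cases h with
    | cons q h => simp [hcons, sellerStep_zero]
    | nil =>
      cases x with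
      | succ x =>
        rw [sellerStep_of_le _ _ le_add_self]
        simp
      | zero =>
        have hk : ((postedPriceSeller S p).meas []).kraus 0 = 1 := rfl
        rw [List.map_nil, sellerStep, hk, onSeller_one, stateAfter, initialState_eq_pureState,
          applyOp_pureState, trace_pureState, Matrix.one_mulVec]
        simp [ampNormSq, Pi.single_apply, apply_ite Complex.normSq]

theorem hasSum_endProb_postedPriceSeller (s : BuyerStrategy) (φ : Ending → ℝ) :
    HasSum (fun e => endProb (postedPriceSeller S p) s e * φ e) (φ ([], 0, none)) := by
  have h := hasSum_ite_eq (([], 0, none) : Ending) (φ ([], 0, none))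
  convert h using 1
  ext e
  rw [endProb_postedPriceSeller]
  split_ifs with he
  · rw [he, one_mul]
  · rw [zero_mul]

/-- The buyer has no move at all, not even a refusal, so individual rationality requires that every
type values `S` at `p` or more. -/
theorem exists_postedPrice_protocol (X : Set (BundleValuation n)) (hp : ∀ v ∈ X, p ≤ v S) :
    ∃ P : QuantumAuctionProtocol X, P.IsProper ∧ P.IsIC ∧ P.IsIR ∧ (∀ v, P.payment v = p) ∧
      ∀ s, expectedQubits P.seller s = 0 := by
  have hu : ∀ s v, expectedUtility (postedPriceSeller S p) s v = v S - p := fun s v =>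
    (hasSum_endProb_postedPriceSeller S p s _).tsum_eq
  refine ⟨⟨postedPriceSeller S p, fun _ => ⟨0, fun _ => ⟨1, fun _ => 1, by simp⟩, fun _ => true⟩⟩,
    fun s => ⟨?_, (hasSum_endProb_postedPriceSeller S p s _).summable⟩, fun v s => ?_, fun v => ?_,
    fun v => (hasSum_endProb_postedPriceSeller S p _ _).tsum_eq, fun s => ?_⟩
  · simpa using hasSum_endProb_postedPriceSeller S p s fun _ => 1
  · rw [hu, hu]
  · rw [hu]
    exact sub_nonneg.mpr (hp v v.2)
  · rw [expectedQubits, ENNReal.tsum_eq_zero]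
    intro e
    rw [endProb_postedPriceSeller]
    split_ifs with he
    · simp [he, Ending.qubits]
    · simp

end PostedPrice

/-! ### The logarithmic bound and the choice of parameters -/

/-- Rounding up costs at most one qubit, and `Real.log 2 ≤ Real.log B` absorbs the additive
constants: the true factor is `5 / Real.log 2 < 9`. -/
theorem two_mul_clog_add_one_le {B : ℕ} (hB : 2 ≤ B) :
    (2 * (Nat.clog 2 B : ℝ) + 1) ≤ 9 * Real.log B := by
  have hk : 1 ≤ Nat.clog 2 B := Nat.clog_pos one_lt_two hB
  have h1 : 2 ^ (Nat.clog 2 B - 1) < B := Nat.pow_pred_clog_lt_self one_lt_two hB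
  have h2 : ((Nat.clog 2 B - 1 : ℕ) : ℝ) * Real.log 2 ≤ Real.log B := by
    rw [← Real.log_pow]
    refine Real.log_le_log (by positivity) ?_
    exact_mod_cast h1.le
  have h3 : Real.log 2 ≤ Real.log B := Real.log_le_log two_pos (by exact_mod_cast hB)
  rw [Nat.cast_sub hk, Nat.cast_one] at h2
  have h4 := Real.log_two_gt_d9
  have h5 : (1 : ℝ) ≤ Nat.clog 2 B := by exact_mod_cast hk
  nlinarith

end

theorem theorem1 :
    ∃ C : ℝ, ∀ (n : ℕ) (X : Set (BundleValuation n)) (U : ℝ),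
      (∀ v ∈ X, ∀ S, 0 ≤ v S ∧ v S ≤ U) →
      ∀ (D : Measure X) [IsProbabilityMeasure D] (M : Mechanism X),
        M.IsIC → M.IsIR → Integrable M.pay D →
      ∀ (B : ℕ) (𝓑 : Finset (Finset (Fin n))), 𝓑.card = B → M.AllocatesOnly 𝓑 →
      ∀ δ : ℝ, 0 < δ →
      ∃ P : QuantumAuctionProtocol X,
        P.IsProper ∧ P.IsIC ∧ P.IsIR ∧
        Integrable P.payment D ∧ (1 - δ) * M.revenue D ≤ P.revenue D ∧
        ∀ s : BuyerStrategy, expectedQubits P.seller s ≤ ENNReal.ofReal (C * Real.log B) := by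
  refine ⟨9, fun n X U hU D _ M hIC hIR hint B 𝓑 hB h𝓑 δ hδ => ?_⟩
  have hX : Nonempty X := nonempty_of_isProbabilityMeasure D
  have posted : ∀ (S : Finset (Fin n)) (p : ℝ), (∀ v ∈ X, p ≤ v S) →
      (1 - δ) * M.revenue D ≤ p → ∃ P : QuantumAuctionProtocol X,
        P.IsProper ∧ P.IsIC ∧ P.IsIR ∧
        Integrable P.payment D ∧ (1 - δ) * M.revenue D ≤ P.revenue D ∧
        ∀ s : BuyerStrategy, expectedQubits P.seller s ≤ ENNReal.ofReal (9 * Real.log B) := by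
    intro S p hp hrev
    obtain ⟨P, h1, h2, h3, h4, h5⟩ := exists_postedPrice_protocol S p X hp
    have h6 : P.payment = fun _ => p := funext h4
    refine ⟨P, h1, h2, h3, ?_, ?_, fun s => ?_⟩
    · rw [h6]
      exact integrable_const p
    · rw [QuantumAuctionProtocol.revenue, h6]
      simpa using hrev
    · rw [h5]
      exact zero_le
  have hrev0 : 0 ≤ M.revenue D := integral_nonneg M.pay_nonneg
  rcases le_or_gt ((1 - δ) * M.revenue D) 0 with hneg | hpos
  · exact posted ∅ 0 (fun v hv => (hU v hv ∅).1) hneg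
  have hδ1 : δ < 1 := by
    by_contra h
    nlinarith
  have hrev : 0 < M.revenue D := by
    by_contra h
    nlinarith
  -- For `B < 2` the bound allows no qubits, as `Real.log B = 0`. Then `M` always gives away the
  -- same bundle, incentive compatibility makes its payment constant, and a posted price suffices.
  rcases lt_or_ge B 2 with hB2 | hB2
  · have hsingle : ∃ S, ∀ T ∈ 𝓑, T = S := by
      have := Finset.card_le_one_iff_subset_singleton.mp (by omega : 𝓑.card ≤ 1)
      obtain ⟨S, hS⟩ := this
      exact ⟨S, fun T hT => Finset.mem_singleton.mp (hS hT)⟩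
    obtain ⟨S, hS⟩ := hsingle
    have hzero : ∀ v T, T ≠ S → M.alloc v T = 0 := fun v T hT => h𝓑 v T fun h => hT (hS T h)
    have hone : ∀ v, M.alloc v S = 1 := fun v => by
      rw [← M.alloc_sum v]
      exact (Finset.sum_eq_single S (fun T _ hT => hzero v T hT) (by simp)).symm
    have hut : ∀ v w : X, M.utility v w = v.1 S - M.pay w := fun v w => by
      rw [Mechanism.utility, Finset.sum_eq_single S (fun T _ hT => by rw [hzero w T hT, zero_mul])
        (by simp), hone, one_mul]
    obtain ⟨v₀⟩ := hX
    have hpay : ∀ v, M.pay v = M.pay v₀ := fun v => by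
      have h1 := hIC v v₀
      have h2 := hIC v₀ v
      rw [hut, hut] at h1 h2
      linarith
    refine posted S (M.pay v₀) (fun v hv => ?_) ?_
    · have h := hIR ⟨v, hv⟩
      rw [hut, hpay] at h
      linarith
    · have h : M.revenue D = M.pay v₀ := by
        rw [Mechanism.revenue, funext hpay]
        simp
      rw [h]
      nlinarith [M.pay_nonneg v₀]
  -- With `γ = δ / 4` the factor `(1 - γ) ^ 2` loses at most half of `δ`, and `θ` is chosen so that
  -- the additive loss `2 * θ / γ + θ` is the other half.
  · set θ : ℝ := δ / 2 * M.revenue D / (8 / δ + 1)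
    have hθ : 0 < θ := by positivity
    have hθE : 2 * θ / (δ / 4) + θ = δ / 2 * M.revenue D := by
      simp only [θ]
      field_simp
      ring
    obtain ⟨P, h1, h2, h3, h4, h5, h6⟩ := M.exists_approximating_protocol hIC hIR hU h𝓑
      (Nat.clog_pos one_lt_two hB2) (hB.le.trans (Nat.le_pow_clog one_lt_two B))
      (γ := δ / 4) (by positivity) (by linarith) hθ
    refine ⟨P, h1, h2, h3, h4 D, ?_, fun s => (h6 s).trans
      (ENNReal.ofReal_le_ofReal (two_mul_clog_add_one_le hB2))⟩
    have h7 : ∫ v, ((1 - δ / 4) ^ 2 * M.pay v - (2 * θ / (δ / 4) + θ)) ∂D ≤ P.revenue D :=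
      integral_mono ((hint.const_mul _).sub (integrable_const _)) (h4 D) h5
    rw [integral_sub (hint.const_mul _) (integrable_const _), integral_const_mul, hθE] at h7
    simp only [integral_const, probReal_univ, one_smul] at h7
    refine le_trans ?_ h7
    rw [Mechanism.revenue] at *
    nlinarith [mul_nonneg (sq_nonneg (δ / 4)) hrev.le]
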